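/- Let $n\ge 2$ and $m\ge 1$ be integers, $0<\alpha<mn$, $1<s\le\infty$, and let $s'=s/(s-1)$ (with $s'=1$ if $s=\infty$). Let $\Omega_1,\dots,\Omega_m:\mathbb R^n\to\mathbb C$ be homogeneous of degree zero, i.e. $\Omega_i(\lambda x)=\Omega_i(x)$ for all $\lambda>0$ and $x\in\mathbb R^n$, with $\Omega_i|_{\mathbf S^{n-1}}\in L^s(\mathbf S^{n-1})$ with respect to the normalized surface measure. For $f_1,\dots,f_m:\mathbb R^n\to\mathbb C$ put $$\mathcal T_{\Omega,\alpha;m}(\vec f)(x)=\int_{(\mathbb R^n)^m}\frac{\Omega_1(x-y_1)\cdots\Omega_m(x-y_m)}{\big(\sum_{j=1}^m|x-y_j|^2\big)^{(mn-\alpha)/2}}\,f_1(y_1)\cdots f_m(y_m)\,dy_1\cdots dy_m .$$ For $0<r<\infty$ and $0<\kappa<1$ and measurable $f:\mathbb R^n\to\mathbb C$ let $$\|f\|_{L^{r,\kappa}}=\sup_B\Big(\frac1{|B|^{\kappa}}\int_B|f(x)|^r\,dx\Big)^{1/r},\qquad \|f\|_{WL^{r,\kappa}}=\sup_B\sup_{\lambda>0}\frac{\lambda\,\big|\{x\in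 B:|f(x)|>\lambda\}\big|^{1/r}}{|B|^{\kappa/r}},$$ where $B$ runs over all open balls of $\mathbb R^n$ and $|\cdot|$ is Lebesgue measure; $L^{r,\kappa}$ and $WL^{r,\kappa}$ are the spaces of measurable functions for which the respective quantity is finite. Let $s'\le p_1,\dots,p_m<\infty$, let $1/p=1/p_1+\cdots+1/p_m$, and assume $0<\kappa<1-\alpha p/n$ and $1/q=1/p-\alpha/[n(1-\kappa)]$. (i) If $p_i>s'$ for all $i$, then there is a constant $C$, independent of $\vec f$, such that for all $\vec f\in L^{p_1,\kappa}\times\cdots\times L^{p_m,\kappa}$ the integral defining $\mathcal T_{\Omega,\alpha;m}(\vec f)(x)$ converges absolutely for almost every $x$, $\mathcal T_{\Omega,\alpha;m}(\vec f)\in L^{q,\kappa}$, and $$\|\mathcal T_{\Omega,\alpha;m}(\vec f)\|_{L^{q,\kappa}}\le C\prod_{i=1}^m\|f_i\|_{L^{p_i,\kappa}} .$$ (ii) If $\min\{p_1,\dots,p_m\}=s'$, then there is a constant $C$, independent of $\vec f$, such that for all $\vec f\in L^{p_1,\kappa}\times\cdots\times L^{p_m,\kappa}$ the integral defining $\mathcal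 T_{\Omega,\alpha;m}(\vec f)(x)$ converges absolutely for almost every $x$, $\mathcal T_{\Omega,\alpha;m}(\vec f)\in WL^{q,\kappa}$, and $$\|\mathcal T_{\Omega,\alpha;m}(\vec f)\|_{WL^{q,\kappa}}\le C\prod_{i=1}^m\|f_i\|_{L^{p_i,\kappa}} .$$ -/

import Mathlib

open MeasureTheory
open scoped ENNReal NNReal

/-- The normalized surface measure `dσ` on the unit sphere of `ℝⁿ`. -/
noncomputable def sphereMeasure (n : ℕ) :
    Measure (Metric.sphere (0 : EuclideanSpace ℝ (Fin n)) 1) :=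
  ((volume : Measure (EuclideanSpace ℝ (Fin n))).toSphere Set.univ)⁻¹ •
    (volume : Measure (EuclideanSpace ℝ (Fin n))).toSphere

/-- `Ω` is homogeneous of degree zero on `ℝⁿ` and `Ω ∈ L^s(S^{n-1})`. -/
def IsHomogeneousLs {n : ℕ} (s : ℝ≥0∞) (Ω : EuclideanSpace ℝ (Fin n) → ℂ) : Prop :=
  (∀ t : ℝ, 0 < t → ∀ x, Ω (t • x) = Ω x) ∧
    MemLp (fun x : Metric.sphere (0 : EuclideanSpace ℝ (Fin n)) 1 => Ω x) s (sphereMeasure n)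

/-- The Morrey norm `sup_B (m(B)^{-κ} ∫_B |f|^p)^{1/p}`, the supremum being over all open balls. -/
noncomputable def morreyNorm {n : ℕ} (p κ : ℝ) (f : EuclideanSpace ℝ (Fin n) → ℂ) : ℝ≥0∞ :=
  ⨆ (x : EuclideanSpace ℝ (Fin n)) (r : ℝ) (_ : 0 < r),
    ((∫⁻ y in Metric.ball x r, ‖f y‖ₑ ^ p) / volume (Metric.ball x r) ^ κ) ^ (1 / p)

/-- Membership in the Morrey space `L^{p,κ}(ℝⁿ)`. -/
def MemMorrey {n : ℕ} (p κ : ℝ) (f : EuclideanSpace ℝ (Fin n) → ℂ) : Prop :=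
  AEStronglyMeasurable f volume ∧ morreyNorm p κ f < ∞

/-- The weak Morrey quasi-norm
`sup_B sup_{t > 0} m(B)^{-κ/p} t m({y ∈ B : |f y| > t})^{1/p}`. -/
noncomputable def weakMorreyNorm {n : ℕ} (p κ : ℝ) (f : EuclideanSpace ℝ (Fin n) → ℂ) : ℝ≥0∞ :=
  ⨆ (x : EuclideanSpace ℝ (Fin n)) (r : ℝ) (_ : 0 < r) (t : ℝ) (_ : 0 < t),
    ENNReal.ofReal t * volume {y ∈ Metric.ball x r | t < ‖f y‖} ^ (1 / p) /
      volume (Metric.ball x r) ^ (κ / p)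

/-- Membership in the weak Morrey space `WL^{p,κ}(ℝⁿ)`. -/
def MemWeakMorrey {n : ℕ} (p κ : ℝ) (f : EuclideanSpace ℝ (Fin n) → ℂ) : Prop :=
  AEStronglyMeasurable f volume ∧ weakMorreyNorm p κ f < ∞

/-- The integrand `(y₁, …, y_m) ↦
Ω₁(x-y₁)⋯Ω_m(x-y_m) / ‖(x-y₁, …, x-y_m)‖^{mn-α} · f₁(y₁)⋯f_m(y_m)`. -/
noncomputable def fracIntegrand {n m : ℕ} (α : ℝ)
    (Ω f : Fin m → EuclideanSpace ℝ (Fin n) → ℂ) (x : EuclideanSpace ℝ (Fin n))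
    (y : Fin m → EuclideanSpace ℝ (Fin n)) : ℂ :=
  (∏ i, Ω i (x - y i)) /
      ((Real.sqrt (∑ j, ‖x - y j‖ ^ 2) ^ ((m : ℝ) * (n : ℝ) - α) : ℝ) : ℂ) *
    ∏ i, f i (y i)

/-- The multilinear fractional integral `𝒯_{Ω,α;m}(f₁, …, f_m)` with homogeneous kernels. -/
noncomputable def fracIntegral {n m : ℕ} (α : ℝ)
    (Ω f : Fin m → EuclideanSpace ℝ (Fin n) → ℂ) (x : EuclideanSpace ℝ (Fin n)) : ℂ :=
  ∫ y : Fin m → EuclideanSpace ℝ (Fin n), fracIntegrand α Ω f x y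

/-!
The proof rests on Hedberg's pointwise inequality. Split the kernel into dyadic shells
`|(x - y₁, …, x - y_m)| ~ 2 ^ k`. On each shell the kernel is dominated by a product of functions of
one `y_i` each, supported on the ball `B(x, 2 ^ k)`, so the integral is at most a constant times
`∑ₖ 2 ^ (k α) ∏ᵢ ⨍_{B(x, 2 ^ k)} |Ω_i(x - y)| |f_i(y)| dy`
(`lintegral_enorm_fracIntegrand_le_tsum`). Hölder's inequality with exponents `s` and `σ = s'`
removes `Ω_i`: by homogeneity its normalized `L ^ s` norm is the same on all balls
(`exists_laverage_ball_enorm_mul_le`).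

Let `N_i` be the Morrey norm of `f_i`, let `u_i = |f_i| / N_i`, let `M` be the maximal function over
dyadic radii and `H_i = (M u_i ^ σ) ^ (p_i / σ)` (`normalizedMaximal`). The `L ^ σ` average of `u_i`
over `B(x, 2 ^ k)` is at most `H_i(x) ^ (1 / p_i)`, and, by the Morrey condition, at most
`|B(x, 2 ^ k)| ^ ((κ - 1) / p_i)`. Hence, with `S = ∑ᵢ H_i`, the `k`-th summand is at most a constant
times `(∏ᵢ N_i) 2 ^ (k α) min (S ^ (1 / P)) (2 ^ (-k n (1 - κ) / P))`. As `0 < α < n (1 - κ) / P`, the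
sum over `k` is at most a constant times its largest term (`exists_tsum_two_rpow_mul_min_le`), which
gives `|𝒯(f)(x)| ≤ C (∏ᵢ N_i) S(x) ^ (1 / q)` (`exists_lintegral_enorm_fracIntegrand_le`).

It remains to integrate `S` over a ball `B`. If `p_i > σ`, then `∫_B H_i ≤ C |B| ^ κ`, because `M` is
bounded on Morrey spaces with exponent `p_i / σ > 1`. If only `p_i ≥ σ`, then `H_i ≤ M (u_i ^ p_i)` by
Jensen's inequality, and the weak type `(1, 1)` bound of `M` gives `t |{H_i > t} ∩ B| ≤ C |B| ^ κ`.
The latter also shows that `S` is finite, and so the integral absolutely convergent, almost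
everywhere. Both Morrey space bounds come from those on the whole space, as on `B` the function `M g`
is at most the larger of `M (g 1_{2B})` and a constant (`dyadicMaximal_rpow_le_max`).
-/

open Metric

/-! ### A dyadic sum -/

theorem tsum_two_rpow_neg_mul_abs_ne_top {δ : ℝ} (hδ : 0 < δ) :
    ∑' k : ℤ, (2 : ℝ≥0∞) ^ (-δ * |(k : ℝ)|) ≠ ∞ := by
  have hr0 : (0 : ℝ) ≤ (2 : ℝ) ^ (-δ) := by positivity
  have hr1 : (2 : ℝ) ^ (-δ) < 1 := Real.rpow_lt_one_of_one_lt_of_neg (by norm_num) (by linarith)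
  have hs : Summable fun k : ℤ => ((2 : ℝ) ^ (-δ * |(k : ℝ)|)) := by
    apply Summable.of_nat_of_neg
    all_goals
      refine (summable_geometric_of_lt_one hr0 hr1).congr fun k => ?_
      rw [← Real.rpow_mul_natCast (by norm_num)]
      simp
  convert hs.tsum_ofReal_ne_top using 4 with k
  rw [← ENNReal.ofReal_rpow_of_pos (by norm_num)]
  simp

/-- A dyadic sum of the smaller of an increasing and a decreasing geometric sequence is dominated
by its largest term; that term is located at the real number `t` with `B = 2 ^ (t * b) * A`. -/
theorem exists_tsum_two_rpow_mul_min_le {a b : ℝ} (ha : 0 < a) (hab : a < b) :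
    ∃ C : ℝ≥0, ∀ A B : ℝ≥0∞,
      ∑' k : ℤ, (2 : ℝ≥0∞) ^ (k * a) * min A (2 ^ (-(k * b)) * B) ≤
        C * (A ^ (1 - a / b) * B ^ (a / b)) := by
  have hb : 0 < b := ha.trans hab
  have hθ : 0 < a / b := by positivity
  have hθ1 : 0 < 1 - a / b := by rw [sub_pos, div_lt_one hb]; exact hab
  set δ := min a (b - a) with hδdef
  have hδ : 0 < δ := lt_min ha (by linarith)
  have h2 : (2 : ℝ≥0∞) ≠ 0 := by norm_num
  have h2' : (2 : ℝ≥0∞) ≠ ∞ := by norm_num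
  have hS := tsum_two_rpow_neg_mul_abs_ne_top hδ
  set S := ∑' k : ℤ, (2 : ℝ≥0∞) ^ (-δ * |(k : ℝ)|) with hSdef
  have hS0 : S ≠ 0 := by
    intro h
    have := ENNReal.tsum_eq_zero.1 h 0
    simp at this
  have hC : 2 ^ δ * S ≠ ∞ := ENNReal.mul_ne_top (by simp [h2, h2']) hS
  have hC0 : 2 ^ δ * S ≠ 0 := mul_ne_zero (by simp [h2, h2']) hS0
  refine ⟨(2 ^ δ * S).toNNReal, fun A B => ?_⟩
  rw [ENNReal.coe_toNNReal hC]
  rcases eq_or_ne A 0 with rfl | hA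
  · simp
  rcases eq_or_ne B 0 with rfl | hB
  · simp
  rcases eq_or_ne A ∞ with rfl | hA'
  · rw [ENNReal.top_rpow_of_pos hθ1, ENNReal.top_mul (by simp [hB, hθ.not_gt]), ENNReal.mul_top hC0]
    exact le_top
  rcases eq_or_ne B ∞ with rfl | hB'
  · rw [ENNReal.top_rpow_of_pos hθ, ENNReal.mul_top (by simp [hA, hA', hθ1.not_gt]),
      ENNReal.mul_top hC0]
    exact le_top
  obtain ⟨t, ht⟩ : ∃ t : ℝ, B = 2 ^ (t * b) * A := by
    have hAr : 0 < A.toReal := ENNReal.toReal_pos hA hA'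
    have hBr : 0 < B.toReal := ENNReal.toReal_pos hB hB'
    refine ⟨Real.logb 2 (B.toReal / A.toReal) / b, ?_⟩
    rw [div_mul_cancel₀ _ hb.ne', ← ENNReal.ofReal_toReal hB', ← ENNReal.ofReal_toReal hA',
      show (2 : ℝ≥0∞) = ENNReal.ofReal 2 by simp, ENNReal.ofReal_rpow_of_pos (by norm_num),
      ← ENNReal.ofReal_mul (by positivity), ENNReal.toReal_ofReal hAr.le,
      ENNReal.toReal_ofReal hBr.le, Real.rpow_logb (by norm_num) (by norm_num) (by positivity)]
    congr 1
    field_simp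
  have hR : A ^ (1 - a / b) * B ^ (a / b) = 2 ^ (t * a) * A := by
    rw [ht, ENNReal.mul_rpow_of_nonneg _ _ hθ.le, ← ENNReal.rpow_mul, mul_left_comm,
      ← ENNReal.rpow_add _ _ hA hA', show t * b * (a / b) = t * a by field_simp]
    simp
  have hmono : ∀ {u v : ℝ}, u ≤ v → (2 : ℝ≥0∞) ^ u ≤ 2 ^ v := fun h =>
    ENNReal.rpow_le_rpow_of_exponent_le (by norm_num) h
  -- The terms decay geometrically away from `k = t`; passing from `t` to `⌊t⌋` costs `2 ^ δ`.
  have hterm : ∀ k : ℤ, (2 : ℝ≥0∞) ^ (k * a) * min A (2 ^ (-(k * b)) * B) ≤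
      2 ^ δ * (2 ^ (t * a) * A) * 2 ^ (-δ * |((k - ⌊t⌋ : ℤ) : ℝ)|) := by
    intro k
    have h1 : |((k - ⌊t⌋ : ℤ) : ℝ)| ≤ |(k : ℝ) - t| + 1 := by
      push_cast
      calc |(k : ℝ) - ⌊t⌋| = |((k : ℝ) - t) + (t - ⌊t⌋)| := by ring_nf
        _ ≤ |(k : ℝ) - t| + |t - ⌊t⌋| := abs_add_le _ _
        _ ≤ _ := by
          gcongr
          exact (abs_of_nonneg (Int.fract_nonneg t)).trans_le (Int.fract_lt_one t).le
    have h3 : 2 ^ δ * (2 ^ (t * a) * A) * 2 ^ (-δ * |((k - ⌊t⌋ : ℤ) : ℝ)|) =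
        2 ^ (δ + t * a + -δ * |((k - ⌊t⌋ : ℤ) : ℝ)|) * A := by
      rw [ENNReal.rpow_add _ _ h2 h2', ENNReal.rpow_add _ _ h2 h2']
      ring
    rw [h3]
    have h4 : δ * |((k - ⌊t⌋ : ℤ) : ℝ)| ≤ δ * (|(k : ℝ) - t| + 1) := by gcongr
    rcases le_total (k : ℝ) t with hk | hk
    · refine (mul_le_mul_right (min_le_left _ _) _).trans (mul_le_mul_left (hmono ?_) A)
      rw [abs_of_nonpos (by linarith : (k : ℝ) - t ≤ 0)] at h4
      have : δ * (t - k) ≤ a * (t - k) :=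
        mul_le_mul_of_nonneg_right (min_le_left _ _) (by linarith)
      nlinarith
    · refine (mul_le_mul_right (min_le_right _ _) _).trans ?_
      rw [ht, ← mul_assoc, ← mul_assoc, ← ENNReal.rpow_add _ _ h2 h2',
        ← ENNReal.rpow_add _ _ h2 h2']
      refine mul_le_mul_left (hmono ?_) A
      rw [abs_of_nonneg (by linarith : 0 ≤ (k : ℝ) - t)] at h4
      have : δ * (k - t) ≤ (b - a) * (k - t) :=
        mul_le_mul_of_nonneg_right (min_le_right _ _) (by linarith)
      nlinarith
  calc _ ≤ ∑' k : ℤ, 2 ^ δ * (2 ^ (t * a) * A) * 2 ^ (-δ * |((k - ⌊t⌋ : ℤ) : ℝ)|) :=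
        ENNReal.tsum_le_tsum hterm
    _ = 2 ^ δ * (2 ^ (t * a) * A) * S := by
      rw [ENNReal.tsum_mul_left, hSdef]
      congr 1
      exact (Equiv.subRight ⌊t⌋).tsum_eq fun k : ℤ => (2 : ℝ≥0∞) ^ (-δ * |(k : ℝ)|)
    _ = _ := by rw [hR]; ring

/-! ### The dyadic maximal function -/

section Maximal

set_option linter.unusedSectionVars false

variable {E : Type*} [NormedAddCommGroup E] [NormedSpace ℝ E] [FiniteDimensional ℝ E]
  [MeasurableSpace E] [BorelSpace E] (μ : Measure E) [μ.IsAddHaarMeasure]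

/-- The centred Hardy–Littlewood maximal function over balls of radius `2 ^ k`, `k ∈ ℤ`. The
restriction to dyadic radii makes it a countable supremum. -/
noncomputable def dyadicMaximal (g : E → ℝ≥0∞) (x : E) : ℝ≥0∞ :=
  ⨆ k : ℤ, ⨍⁻ y in ball x ((2 : ℝ) ^ k), g y ∂μ

theorem measure_ball_mul [Nontrivial E] (x : E) {r : ℝ} (hr : 0 < r) (s : ℝ) :
    μ (ball x (r * s)) = ENNReal.ofReal r ^ (Module.finrank ℝ E : ℝ) * μ (ball x s) := by
  rw [Measure.addHaar_ball_mul_of_pos μ x hr, Measure.addHaar_ball_center μ x s,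
    ENNReal.rpow_natCast, ENNReal.ofReal_pow hr.le]

theorem measure_ball_two_zpow [Nontrivial E] (x : E) (k : ℤ) :
    μ (ball x ((2 : ℝ) ^ k)) = 2 ^ ((k : ℝ) * Module.finrank ℝ E) * μ (ball (0 : E) 1) := by
  have := measure_ball_mul μ x (r := (2 : ℝ) ^ k) (by positivity) 1
  rw [mul_one, Measure.addHaar_ball_center μ x 1] at this
  rw [this, ENNReal.rpow_mul, ← Real.rpow_intCast, ← ENNReal.ofReal_rpow_of_pos (by norm_num)]
  simp

theorem measurable_lintegral_ball {g : E → ℝ≥0∞} (hg : AEMeasurable g μ) (r : ℝ) :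
    Measurable fun x => ∫⁻ y in ball x r, g y ∂μ := by
  have h : (fun x => ∫⁻ y in ball x r, g y ∂μ) =
      fun x => ∫⁻ y, {z : E × E | dist z.2 z.1 < r}.indicator (fun z => hg.mk g z.2) (x, y) ∂μ := by
    ext x
    rw [setLIntegral_congr_fun_ae measurableSet_ball (hg.ae_eq_mk.mono fun y hy _ => hy),
      ← lintegral_indicator measurableSet_ball]
    rfl
  rw [h]
  refine Measurable.lintegral_prod_right' ?_
  exact (hg.measurable_mk.comp measurable_snd).indicator
    (measurableSet_lt (measurable_snd.dist measurable_fst) measurable_const)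

theorem laverage_ball_eq (g : E → ℝ≥0∞) (x : E) (r : ℝ) :
    ⨍⁻ y in ball x r, g y ∂μ = (∫⁻ y in ball x r, g y ∂μ) / μ (ball 0 r) := by
  rw [setLAverage_eq, Measure.addHaar_ball_center]

theorem measurable_dyadicMaximal {g : E → ℝ≥0∞} (hg : AEMeasurable g μ) :
    Measurable (dyadicMaximal μ g) := by
  refine Measurable.iSup fun k => ?_
  simp_rw [laverage_ball_eq]
  exact (measurable_lintegral_ball μ hg _).div_const _

theorem dyadicMaximal_add_const_le {g h : E → ℝ≥0∞} {c : ℝ≥0∞} (hgh : ∀ y, g y ≤ h y + c) (x : E) :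
    dyadicMaximal μ g x ≤ dyadicMaximal μ h x + c := by
  refine iSup_le fun k => ?_
  have h0 : μ (ball x ((2 : ℝ) ^ k)) ≠ 0 := (measure_ball_pos μ x (by positivity)).ne'
  have h1 : μ (ball x ((2 : ℝ) ^ k)) ≠ ∞ := measure_ball_lt_top.ne
  calc ⨍⁻ y in ball x ((2 : ℝ) ^ k), g y ∂μ ≤ ⨍⁻ y in ball x ((2 : ℝ) ^ k), (h y + c) ∂μ :=
        lintegral_mono hgh
    _ = (⨍⁻ y in ball x ((2 : ℝ) ^ k), h y ∂μ) + c := by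
        rw [setLAverage_eq, setLAverage_eq, lintegral_add_right _ measurable_const,
          setLIntegral_const, ENNReal.add_div, ENNReal.mul_div_cancel_right h0 h1]
    _ ≤ _ := by
        gcongr
        exact le_iSup (fun k : ℤ => ⨍⁻ y in ball x ((2 : ℝ) ^ k), h y ∂μ) k

/-- The weak type `(1, 1)` bound for the maximal function, by Vitali's covering theorem. -/
theorem mul_measure_lt_dyadicMaximal_le [Nontrivial E] (g : E → ℝ≥0∞) (t : ℝ≥0∞) :
    t * μ {x | t < dyadicMaximal μ g x} ≤ 5 ^ (Module.finrank ℝ E : ℝ) * ∫⁻ y, g y ∂μ := by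
  have h5 : (5 : ℝ≥0∞) ^ (Module.finrank ℝ E : ℝ) ≠ 0 := by simp
  rcases eq_or_ne t 0 with rfl | ht
  · simp
  rcases eq_or_ne t ∞ with rfl | ht'
  · simp
  rcases eq_or_ne (∫⁻ y, g y ∂μ) ∞ with hI | hI
  · rw [hI, ENNReal.mul_top h5]
    exact le_top
  -- Centres and exponents of the balls over which `g` has average at least `t`.
  set T : Set (E × ℤ) :=
    {z | t * μ (ball z.1 ((2 : ℝ) ^ z.2)) ≤ ∫⁻ y in ball z.1 ((2 : ℝ) ^ z.2), g y ∂μ} with hT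
  set v := μ (ball (0 : E) 1) with hv
  have hv0 : v ≠ 0 := (measure_ball_pos μ _ one_pos).ne'
  have hv1 : v ≠ ∞ := measure_ball_lt_top.ne
  -- As `g` is integrable, the radii of these balls are bounded.
  have hbdd : ∀ z ∈ T, (2 : ℝ) ^ z.2 ≤ max 1 ((∫⁻ y, g y ∂μ) / (t * v)).toReal := by
    intro z hz
    by_contra! hlt
    obtain ⟨h1, h2⟩ := max_lt_iff.1 hlt
    have h3 : ENNReal.ofReal ((2 : ℝ) ^ z.2) * v ≤ μ (ball z.1 ((2 : ℝ) ^ z.2)) := by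
      have := measure_ball_mul μ z.1 (r := (2 : ℝ) ^ z.2) (by positivity) 1
      rw [mul_one, Measure.addHaar_ball_center μ z.1 1] at this
      rw [this]
      refine mul_le_mul_left ?_ _
      conv_lhs => rw [← ENNReal.rpow_one (ENNReal.ofReal _)]
      refine ENNReal.rpow_le_rpow_of_exponent_le (by simpa using h1.le) ?_
      exact_mod_cast Module.finrank_pos (R := ℝ) (M := E)
    have h4 : ENNReal.ofReal ((2 : ℝ) ^ z.2) ≤ (∫⁻ y, g y ∂μ) / (t * v) := by
      rw [ENNReal.le_div_iff_mul_le (by simp [ht, hv0]) (by simp [ht', hv1, ENNReal.mul_eq_top])]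
      calc ENNReal.ofReal ((2 : ℝ) ^ z.2) * (t * v) = t * (ENNReal.ofReal ((2 : ℝ) ^ z.2) * v) := by
            ring
        _ ≤ t * μ (ball z.1 ((2 : ℝ) ^ z.2)) := by gcongr
        _ ≤ _ := (show _ from hz).trans (setLIntegral_le_lintegral _ _)
    have h5 := (ENNReal.ofReal_le_iff_le_toReal
      (ENNReal.div_ne_top hI (mul_ne_zero ht hv0))).1 h4
    exact absurd h5 (not_le.2 h2)
  obtain ⟨u, huT, hdisj, hcov⟩ := Vitali.exists_disjoint_subfamily_covering_enlargement_closedBall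
    T (fun z => z.1) (fun z => (2 : ℝ) ^ z.2) _ hbdd 5 (by norm_num)
  have hdisj' : u.PairwiseDisjoint fun z => ball z.1 ((2 : ℝ) ^ z.2) :=
    hdisj.mono fun z => ball_subset_closedBall
  have hu : u.Countable := hdisj'.countable_of_isOpen (fun _ _ => isOpen_ball)
    fun z _ => nonempty_ball.2 (by positivity)
  have hsub : {x | t < dyadicMaximal μ g x} ⊆
      ⋃ z ∈ u, closedBall z.1 (5 * (2 : ℝ) ^ z.2) := by
    intro x hx
    obtain ⟨k, hk⟩ := lt_iSup_iff.1 (show t < dyadicMaximal μ g x from hx)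
    have h0 : μ (ball x ((2 : ℝ) ^ k)) ≠ 0 := (measure_ball_pos μ x (by positivity)).ne'
    have h1 : μ (ball x ((2 : ℝ) ^ k)) ≠ ∞ := measure_ball_lt_top.ne
    have hxT : (x, k) ∈ T := by
      rw [setLAverage_eq, ENNReal.lt_div_iff_mul_lt (.inl h0) (.inl h1)] at hk
      exact hk.le
    obtain ⟨z, hz, hxz⟩ := hcov _ hxT
    exact Set.mem_biUnion hz (hxz (mem_closedBall_self (by positivity)))
  calc t * μ {x | t < dyadicMaximal μ g x}
      ≤ t * ∑' z : u, μ (closedBall z.1.1 (5 * (2 : ℝ) ^ z.1.2)) := by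
        gcongr
        exact (measure_mono hsub).trans (measure_biUnion_le μ hu _)
    _ = ∑' z : u, 5 ^ (Module.finrank ℝ E : ℝ) * (t * μ (ball z.1.1 ((2 : ℝ) ^ z.1.2))) := by
        rw [← ENNReal.tsum_mul_left]
        refine tsum_congr fun z => ?_
        rw [Measure.addHaar_closedBall_eq_addHaar_ball,
          measure_ball_mul μ _ (by norm_num)]
        simp only [ENNReal.ofReal_ofNat]
        ring
    _ ≤ ∑' z : u, 5 ^ (Module.finrank ℝ E : ℝ) * ∫⁻ y in ball z.1.1 ((2 : ℝ) ^ z.1.2), g y ∂μ :=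
        ENNReal.tsum_le_tsum fun z => mul_le_mul_right (huT z.2) _
    _ = 5 ^ (Module.finrank ℝ E : ℝ) *
          ∫⁻ y in ⋃ z ∈ u, ball z.1 ((2 : ℝ) ^ z.2), g y ∂μ := by
        rw [ENNReal.tsum_mul_left, lintegral_biUnion hu (fun _ _ => measurableSet_ball) hdisj']
    _ ≤ _ := mul_le_mul_right (setLIntegral_le_lintegral _ _) _

/-- The maximal function is bounded on `L ^ ρ` for `1 < ρ`. The level sets of `M g` at height
`2 ^ (j + 1)` are controlled by the part of `g` above `2 ^ j`, and the resulting dyadic sum over `j`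
is a geometric sum. -/
theorem exists_lintegral_dyadicMaximal_rpow_le [Nontrivial E] {ρ : ℝ} (hρ : 1 < ρ) :
    ∃ C : ℝ≥0, ∀ g : E → ℝ≥0∞, AEMeasurable g μ →
      ∫⁻ x, dyadicMaximal μ g x ^ ρ ∂μ ≤ C * ∫⁻ x, g x ^ ρ ∂μ := by
  obtain ⟨C, hC⟩ := exists_tsum_two_rpow_mul_min_le (a := ρ - 1) (b := ρ) (by linarith) (by linarith)
  have hρ0 : 0 < ρ := by linarith
  set D : ℝ≥0 := (2 : ℝ≥0) ^ (2 * ρ) * 5 ^ (Module.finrank ℝ E : ℝ) with hD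
  have h2 : (2 : ℝ≥0∞) ≠ 0 := by norm_num
  have h2' : (2 : ℝ≥0∞) ≠ ∞ := by norm_num
  refine ⟨D * C, fun g hg => ?_⟩
  have hM := measurable_dyadicMaximal μ hg
  have hlevel : ∀ j : ℤ, (2 : ℝ≥0∞) ^ ((j : ℝ) + 1) *
      μ {x | (2 : ℝ≥0∞) ^ ((j : ℝ) + 1) < dyadicMaximal μ g x} ≤
      2 * 5 ^ (Module.finrank ℝ E : ℝ) * ∫⁻ x, {x | (2 : ℝ≥0∞) ^ (j : ℝ) < g x}.indicator g x ∂μ := by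
    intro j
    set h := {x | (2 : ℝ≥0∞) ^ (j : ℝ) < g x}.indicator g
    have h3 : (2 : ℝ≥0∞) ^ ((j : ℝ) + 1) = 2 * 2 ^ (j : ℝ) := by
      rw [ENNReal.rpow_add _ _ h2 h2', ENNReal.rpow_one, mul_comm]
    have hsub : {x | (2 : ℝ≥0∞) ^ ((j : ℝ) + 1) < dyadicMaximal μ g x} ⊆
        {x | (2 : ℝ≥0∞) ^ (j : ℝ) < dyadicMaximal μ h x} := by
      intro x hx
      have h4 := dyadicMaximal_add_const_le μ (g := g) (h := h) (c := 2 ^ (j : ℝ)) (fun y => by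
        by_cases hy : (2 : ℝ≥0∞) ^ (j : ℝ) < g y
        · rw [show h y = g y from
            Set.indicator_of_mem (show y ∈ {x | (2 : ℝ≥0∞) ^ (j : ℝ) < g x} from hy) g]
          exact le_self_add
        · exact (not_lt.1 hy).trans le_add_self) x
      have h5 := (show _ < _ from hx).trans_le h4
      rw [h3, two_mul] at h5
      exact lt_of_add_lt_add_right h5
    calc _ ≤ 2 * (2 ^ (j : ℝ) * μ {x | (2 : ℝ≥0∞) ^ (j : ℝ) < dyadicMaximal μ h x}) := by
          rw [← mul_assoc, ← h3]
          exact mul_le_mul_right (measure_mono hsub) _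
      _ ≤ 2 * (5 ^ (Module.finrank ℝ E : ℝ) * ∫⁻ x, h x ∂μ) :=
          mul_le_mul_right (mul_measure_lt_dyadicMaximal_le μ h _) _
      _ = _ := by ring
  have hpt : ∀ x, dyadicMaximal μ g x ^ ρ ≤ ∑' j : ℤ, (2 : ℝ≥0∞) ^ (((j : ℝ) + 2) * ρ) *
      {x | (2 : ℝ≥0∞) ^ ((j : ℝ) + 1) < dyadicMaximal μ g x}.indicator 1 x := by
    intro x
    rcases eq_or_ne (dyadicMaximal μ g x) 0 with h0 | h0
    · simp [h0, hρ0]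
    rcases eq_or_ne (dyadicMaximal μ g x) ∞ with h1 | h1
    -- If `M g x = ∞`, the terms with `0 ≤ j` are all at least `1`, so the sum diverges.
    · rw [h1, ENNReal.top_rpow_of_pos hρ0, top_le_iff]
      by_contra hfin
      have h6 := ENNReal.tendsto_cofinite_zero_of_tsum_ne_top hfin
      have h7 := h6.eventually (gt_mem_nhds (zero_lt_one' ℝ≥0∞))
      rw [Filter.eventually_cofinite] at h7
      refine (Set.Ici_infinite (0 : ℤ)) (h7.subset fun j hj => ?_)
      have hj' : (0 : ℝ) ≤ j := by exact_mod_cast hj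
      have hx : x ∈ {x | (2 : ℝ≥0∞) ^ ((j : ℝ) + 1) < dyadicMaximal μ g x} := by
        simp only [Set.mem_ofPred_eq, h1]
        exact ENNReal.rpow_lt_top_of_nonneg (by positivity) h2'
      simp only [Set.mem_ofPred_eq, not_lt]
      rw [Set.indicator_of_mem hx, Pi.one_apply, mul_one]
      exact ENNReal.one_le_rpow (by norm_num) (by positivity)
    -- Otherwise the term with `2 ^ (j + 1) < M g x ≤ 2 ^ (j + 2)` suffices.
    · obtain ⟨k, hk1, hk2⟩ := ENNReal.exists_mem_Ioc_zpow h0 h1 (y := 2) (by norm_num) h2'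
      have hmem : x ∈ {x | (2 : ℝ≥0∞) ^ (((k - 1 : ℤ) : ℝ) + 1) < dyadicMaximal μ g x} := by
        simp only [Set.mem_ofPred_eq]
        push_cast
        rwa [sub_add_cancel, ENNReal.rpow_intCast]
      refine le_trans ?_ (ENNReal.le_tsum (k - 1))
      rw [Set.indicator_of_mem hmem, Pi.one_apply, mul_one, ENNReal.rpow_mul]
      refine ENNReal.rpow_le_rpow ?_ hρ0.le
      refine hk2.trans_eq ?_
      rw [← ENNReal.rpow_intCast]
      push_cast
      ring_nf
  have hmeas : ∀ j : ℤ, MeasurableSet {x | (2 : ℝ≥0∞) ^ ((j : ℝ) + 1) < dyadicMaximal μ g x} :=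
    fun j => measurableSet_lt measurable_const hM
  have hnull : ∀ j : ℤ, NullMeasurableSet {x | (2 : ℝ≥0∞) ^ (j : ℝ) < g x} μ :=
    fun j => nullMeasurableSet_lt aemeasurable_const hg
  have hgsum : ∀ x, ∑' j : ℤ, (2 : ℝ≥0∞) ^ (j * (ρ - 1)) *
      {x | (2 : ℝ≥0∞) ^ (j : ℝ) < g x}.indicator g x ≤ C * g x ^ ρ := by
    intro x
    -- On `2 ^ j < g x` the minimum below is `1`; it makes the sum an instance of `hC`.
    calc _ ≤ ∑' j : ℤ, (2 : ℝ≥0∞) ^ (j * (ρ - 1)) * min 1 (2 ^ (-(j * ρ)) * g x ^ ρ) * g x := by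
          refine ENNReal.tsum_le_tsum fun j => ?_
          by_cases hj : (2 : ℝ≥0∞) ^ (j : ℝ) < g x
          · rw [Set.indicator_of_mem (show x ∈ {x | (2 : ℝ≥0∞) ^ (j : ℝ) < g x} from hj),
              min_eq_left, mul_one]
            calc (1 : ℝ≥0∞) = 2 ^ (-(j * ρ)) * 2 ^ (j * ρ) := by
                  rw [← ENNReal.rpow_add _ _ h2 h2']; simp
              _ ≤ _ := by
                  gcongr
                  rw [ENNReal.rpow_mul]
                  exact ENNReal.rpow_le_rpow hj.le hρ0.le
          · rw [Set.indicator_of_notMem (by exact hj)]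
            simp
      _ ≤ C * (1 ^ (1 - (ρ - 1) / ρ) * (g x ^ ρ) ^ ((ρ - 1) / ρ)) * g x := by
          rw [ENNReal.tsum_mul_right]
          gcongr
          exact hC _ _
      _ = C * g x ^ ρ := by
          rw [ENNReal.one_rpow, one_mul, ← ENNReal.rpow_mul, mul_div_cancel₀ _ hρ0.ne', mul_assoc]
          congr 1
          conv_lhs => rw [← ENNReal.rpow_one (g x), ← ENNReal.rpow_mul, one_mul,
            ← ENNReal.rpow_add_of_nonneg _ _ (by linarith) zero_le_one]
          simp
  calc ∫⁻ x, dyadicMaximal μ g x ^ ρ ∂μ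
      ≤ ∫⁻ x, ∑' j : ℤ, (2 : ℝ≥0∞) ^ (((j : ℝ) + 2) * ρ) *
          {x | (2 : ℝ≥0∞) ^ ((j : ℝ) + 1) < dyadicMaximal μ g x}.indicator 1 x ∂μ :=
        lintegral_mono hpt
    _ = ∑' j : ℤ, (2 : ℝ≥0∞) ^ (((j : ℝ) + 2) * ρ) *
          μ {x | (2 : ℝ≥0∞) ^ ((j : ℝ) + 1) < dyadicMaximal μ g x} := by
        rw [lintegral_tsum fun j => ((measurable_one.indicator (hmeas j)).const_mul _).aemeasurable]
        refine tsum_congr fun j => ?_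
        rw [lintegral_const_mul _ (measurable_one.indicator (hmeas j)),
          lintegral_indicator_one (hmeas j)]
    _ ≤ ∑' j : ℤ, D * ((2 : ℝ≥0∞) ^ (j * (ρ - 1)) *
          ∫⁻ x, {x | (2 : ℝ≥0∞) ^ (j : ℝ) < g x}.indicator g x ∂μ) := by
        refine ENNReal.tsum_le_tsum fun j => ?_
        have e1 : (2 : ℝ≥0∞) ^ (((j : ℝ) + 2) * ρ) =
            2 ^ (j * (ρ - 1) + 2 * ρ - 1) * 2 ^ ((j : ℝ) + 1) := by
          rw [← ENNReal.rpow_add _ _ h2 h2']; ring_nf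
        have e2 : (2 : ℝ≥0∞) ^ (j * (ρ - 1) + 2 * ρ - 1) * 2 =
            2 ^ (2 * ρ) * 2 ^ (j * (ρ - 1)) := by
          conv_lhs => rw [← ENNReal.rpow_one 2, ← ENNReal.rpow_mul, one_mul,
            ← ENNReal.rpow_add _ _ h2 h2']
          rw [← ENNReal.rpow_add _ _ h2 h2']
          ring_nf
        have e3 : (D : ℝ≥0∞) = 2 ^ (2 * ρ) * 5 ^ (Module.finrank ℝ E : ℝ) := by
          rw [hD, ENNReal.coe_mul, ENNReal.coe_rpow_of_nonneg _ (by positivity),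
            ENNReal.coe_rpow_of_nonneg _ (by positivity)]
          simp
        rw [e1, mul_assoc, e3]
        refine (mul_le_mul_right (hlevel j) _).trans_eq ?_
        rw [← mul_assoc, ← mul_assoc, e2]
        ring
    _ = D * ∫⁻ x, ∑' j : ℤ, (2 : ℝ≥0∞) ^ (j * (ρ - 1)) *
          {x | (2 : ℝ≥0∞) ^ (j : ℝ) < g x}.indicator g x ∂μ := by
        rw [lintegral_tsum fun j => (hg.indicator₀ (hnull j)).const_mul _, ENNReal.tsum_mul_left]
        congr 1
        refine tsum_congr fun j => ?_
        rw [lintegral_const_mul'' _ (hg.indicator₀ (hnull j))]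
    _ ≤ D * ∫⁻ x, C * g x ^ ρ ∂μ := by
        gcongr with x
        exact hgsum x
    _ = _ := by
        rw [lintegral_const_mul' _ _ (by simp), ENNReal.coe_mul D C, mul_assoc]

end Maximal

/-! ### The maximal function on Morrey spaces -/

section LocalMaximal
set_option linter.unusedSectionVars false

variable {E : Type*} [NormedAddCommGroup E] [NormedSpace ℝ E] [FiniteDimensional ℝ E]
  [MeasurableSpace E] [BorelSpace E] (μ : Measure E) [μ.IsAddHaarMeasure]

/-- Jensen's inequality for averages over balls. -/
theorem laverage_ball_rpow_le {g : E → ℝ≥0∞} (hg : AEMeasurable g μ) {ρ : ℝ} (hρ : 1 ≤ ρ)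
    (x : E) {r : ℝ} (hr : 0 < r) :
    (⨍⁻ y in ball x r, g y ∂μ) ^ ρ ≤ ⨍⁻ y in ball x r, g y ^ ρ ∂μ := by
  have hρ0 : 0 < ρ := by linarith
  have : NeZero (μ.restrict (ball x r)) :=
    ⟨by rw [Ne, Measure.restrict_eq_zero]; exact (measure_ball_pos μ x hr).ne'⟩
  have : IsFiniteMeasure (μ.restrict (ball x r)) :=
    ⟨by rw [Measure.restrict_apply_univ]; exact measure_ball_lt_top⟩
  have h := eLpNorm'_le_eLpNorm'_of_exponent_le (f := g) one_pos hρ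
    (((μ.restrict (ball x r)) Set.univ)⁻¹ • μ.restrict (ball x r))
    (hg.restrict.smul_measure _).aestronglyMeasurable
  simp only [eLpNorm', enorm_eq_self, ENNReal.rpow_one, div_one] at h
  rw [one_div, ENNReal.le_rpow_inv_iff hρ0] at h
  exact h

theorem dyadicMaximal_rpow_le {g : E → ℝ≥0∞} (hg : AEMeasurable g μ) {ρ : ℝ} (hρ : 1 ≤ ρ) (x : E) :
    dyadicMaximal μ g x ^ ρ ≤ dyadicMaximal μ (fun y => g y ^ ρ) x := by
  rw [← ENNReal.le_rpow_inv_iff (by linarith)]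
  refine iSup_le fun k => ?_
  rw [ENNReal.le_rpow_inv_iff (by linarith)]
  exact (laverage_ball_rpow_le μ hg hρ x (by positivity)).trans
    (le_iSup (fun k : ℤ => ⨍⁻ y in ball x ((2 : ℝ) ^ k), g y ^ ρ ∂μ) k)

theorem laverage_ball_le_of_lintegral_ball_le {g : E → ℝ≥0∞} {κ : ℝ} {N : ℝ≥0∞} {x : E} {r : ℝ}
    (hr : 0 < r) (hN : ∫⁻ y in ball x r, g y ∂μ ≤ N * μ (ball x r) ^ κ) :
    ⨍⁻ y in ball x r, g y ∂μ ≤ N * μ (ball x r) ^ (κ - 1) := by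
  have h0 : μ (ball x r) ≠ 0 := (measure_ball_pos μ x hr).ne'
  have h1 : μ (ball x r) ≠ ∞ := measure_ball_lt_top.ne
  rw [setLAverage_eq, ENNReal.rpow_sub _ _ h0 h1, ENNReal.rpow_one, ← mul_div_assoc]
  gcongr

/-- On a ball `B`, only the part of `g` on the doubled ball contributes to the averages over small
balls, while the averages over balls larger than `B` are controlled by the Morrey condition. -/
theorem dyadicMaximal_rpow_le_max {g : E → ℝ≥0∞} (hg : AEMeasurable g μ) {ρ κ : ℝ} {N : ℝ≥0∞}
    (hρ : 1 ≤ ρ) (hκ : κ ≤ 1)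
    (hN : ∀ x r, 0 < r → ∫⁻ y in ball x r, g y ^ ρ ∂μ ≤ N * μ (ball x r) ^ κ)
    {x₀ x : E} {r : ℝ} (hx : x ∈ ball x₀ r) :
    dyadicMaximal μ g x ^ ρ ≤ max (dyadicMaximal μ ((ball x₀ (2 * r)).indicator g) x ^ ρ)
      (N * μ (ball x₀ r) ^ (κ - 1)) := by
  have hρ0 : 0 < ρ := by linarith
  have hr : 0 < r := dist_nonneg.trans_lt (mem_ball.1 hx)
  rw [← ENNReal.le_rpow_inv_iff hρ0]
  refine iSup_le fun k => ?_
  rw [ENNReal.le_rpow_inv_iff hρ0]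
  rcases le_or_gt ((2 : ℝ) ^ k) r with hk | hk
  · refine le_max_of_le_left (ENNReal.rpow_le_rpow ?_ hρ0.le)
    refine le_trans (le_of_eq ?_) (le_iSup
      (fun k : ℤ => ⨍⁻ y in ball x ((2 : ℝ) ^ k), (ball x₀ (2 * r)).indicator g y ∂μ) k)
    refine setLAverage_congr_fun measurableSet_ball fun y hy => ?_
    refine (Set.indicator_of_mem ?_ g).symm
    rw [mem_ball] at hy hx ⊢
    linarith [dist_triangle y x x₀]
  · refine le_max_of_le_right ((laverage_ball_rpow_le μ hg hρ x (by positivity)).trans ?_)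
    refine (laverage_ball_le_of_lintegral_ball_le μ (by positivity) (hN x _ (by positivity))).trans ?_
    refine mul_le_mul_right ?_ _
    rw [← neg_sub, ENNReal.rpow_neg, ENNReal.rpow_neg, ENNReal.inv_le_inv]
    refine ENNReal.rpow_le_rpow ?_ (by linarith)
    rw [Measure.addHaar_ball_center μ x, Measure.addHaar_ball_center μ x₀]
    exact measure_mono (ball_subset_ball hk.le)

theorem mul_rpow_sub_one_mul_measure_ball (N : ℝ≥0∞) (κ : ℝ) (x : E) {r : ℝ} (hr : 0 < r) :
    N * μ (ball x r) ^ (κ - 1) * μ (ball x r) = N * μ (ball x r) ^ κ := by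
  have h0 : μ (ball x r) ≠ 0 := (measure_ball_pos μ x hr).ne'
  have h1 : μ (ball x r) ≠ ∞ := measure_ball_lt_top.ne
  rw [mul_assoc, ENNReal.rpow_sub _ _ h0 h1, ENNReal.rpow_one, ENNReal.div_mul_cancel h0 h1]

/-- The maximal function satisfies the weak type `(1, 1)` bound on Morrey spaces. -/
theorem exists_mul_measure_ball_lt_dyadicMaximal_le [Nontrivial E] {κ : ℝ} (hκ0 : 0 ≤ κ)
    (hκ : κ ≤ 1) :
    ∃ C : ℝ≥0, ∀ (g : E → ℝ≥0∞) (N : ℝ≥0∞), AEMeasurable g μ →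
      (∀ x r, 0 < r → ∫⁻ y in ball x r, g y ∂μ ≤ N * μ (ball x r) ^ κ) →
      ∀ (x : E) (r : ℝ), 0 < r → ∀ t,
        t * μ {y ∈ ball x r | t < dyadicMaximal μ g y} ≤ C * (N * μ (ball x r) ^ κ) := by
  set d := (Module.finrank ℝ E : ℝ)
  have hd : 0 ≤ d := Nat.cast_nonneg _
  refine ⟨5 ^ d * (2 ^ d) ^ κ + 1, fun g N hg hN x₀ r hr t => ?_⟩
  have hC : ((5 ^ d * (2 ^ d) ^ κ + 1 : ℝ≥0) : ℝ≥0∞) = 5 ^ d * (2 ^ d) ^ κ + 1 := by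
    push_cast
    rw [ENNReal.coe_rpow_of_nonneg _ hκ0, ENNReal.coe_rpow_of_nonneg _ hd,
      ENNReal.coe_rpow_of_nonneg _ hd]
    simp
  rw [hC, add_mul, one_mul]
  rcases lt_or_ge t (N * μ (ball x₀ r) ^ (κ - 1)) with ht | ht
  -- For small `t` the measure of the whole ball is small enough.
  · refine le_add_left ?_
    rw [← mul_rpow_sub_one_mul_measure_ball μ N κ x₀ hr]
    exact mul_le_mul' ht.le (measure_mono fun y hy => hy.1)
  · refine le_add_right ?_
    set h := (ball x₀ (2 * r)).indicator g with hh
    have hsub : {y ∈ ball x₀ r | t < dyadicMaximal μ g y} ⊆ {y | t < dyadicMaximal μ h y} := by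
      rintro y ⟨hy, hty⟩
      have := dyadicMaximal_rpow_le_max μ hg (ρ := 1) le_rfl hκ (by simpa using hN) hy
      simp only [ENNReal.rpow_one] at this
      rcases le_max_iff.1 this with h1 | h1
      · exact hty.trans_le h1
      · exact absurd (h1.trans ht) (not_le.2 hty)
    calc t * μ {y ∈ ball x₀ r | t < dyadicMaximal μ g y}
        ≤ t * μ {y | t < dyadicMaximal μ h y} := mul_le_mul_right (measure_mono hsub) _
      _ ≤ 5 ^ d * ∫⁻ y in ball x₀ (2 * r), g y ∂μ := by
          rw [← lintegral_indicator measurableSet_ball]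
          exact mul_measure_lt_dyadicMaximal_le μ h t
      _ ≤ 5 ^ d * (N * μ (ball x₀ (2 * r)) ^ κ) := mul_le_mul_right (hN _ _ (by positivity)) _
      _ = _ := by
          rw [measure_ball_mul μ x₀ (by norm_num), ENNReal.mul_rpow_of_nonneg _ _ hκ0,
            ENNReal.ofReal_ofNat]
          ring

/-- The maximal function is bounded on Morrey spaces with exponent `1 < ρ`. -/
theorem exists_lintegral_ball_dyadicMaximal_rpow_le [Nontrivial E] {ρ κ : ℝ} (hρ : 1 < ρ)
    (hκ0 : 0 ≤ κ) (hκ : κ ≤ 1) :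
    ∃ C : ℝ≥0, ∀ (g : E → ℝ≥0∞) (N : ℝ≥0∞), AEMeasurable g μ →
      (∀ x r, 0 < r → ∫⁻ y in ball x r, g y ^ ρ ∂μ ≤ N * μ (ball x r) ^ κ) →
      ∀ (x : E) (r : ℝ), 0 < r →
        ∫⁻ y in ball x r, dyadicMaximal μ g y ^ ρ ∂μ ≤ C * (N * μ (ball x r) ^ κ) := by
  obtain ⟨C, hC⟩ := exists_lintegral_dyadicMaximal_rpow_le μ hρ
  have hρ0 : 0 < ρ := by linarith
  set d := (Module.finrank ℝ E : ℝ)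
  have hd : 0 ≤ d := Nat.cast_nonneg _
  refine ⟨C * (2 ^ d) ^ κ + 1, fun g N hg hN x₀ r hr => ?_⟩
  set h := (ball x₀ (2 * r)).indicator g with hh
  have hhg : AEMeasurable h μ := hg.indicator measurableSet_ball
  have hD : ((C * (2 ^ d) ^ κ + 1 : ℝ≥0) : ℝ≥0∞) = C * (2 ^ d) ^ κ + 1 := by
    push_cast
    rw [ENNReal.coe_rpow_of_nonneg _ hκ0, ENNReal.coe_rpow_of_nonneg _ hd]
    simp
  calc ∫⁻ y in ball x₀ r, dyadicMaximal μ g y ^ ρ ∂μ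
      ≤ ∫⁻ y in ball x₀ r, (dyadicMaximal μ h y ^ ρ + N * μ (ball x₀ r) ^ (κ - 1)) ∂μ :=
        setLIntegral_mono' measurableSet_ball fun y hy =>
          (dyadicMaximal_rpow_le_max μ hg hρ.le hκ hN hy).trans (max_le_add_of_nonneg zero_le zero_le)
    _ = ∫⁻ y in ball x₀ r, dyadicMaximal μ h y ^ ρ ∂μ + N * μ (ball x₀ r) ^ κ := by
        rw [lintegral_add_right _ measurable_const, setLIntegral_const,
          mul_rpow_sub_one_mul_measure_ball μ N κ x₀ hr]
    _ ≤ C * (N * μ (ball x₀ (2 * r)) ^ κ) + N * μ (ball x₀ r) ^ κ := by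
        refine add_le_add_left ?_ _
        refine (setLIntegral_le_lintegral _ _).trans ((hC h hhg).trans ?_)
        refine mul_le_mul_right ((le_of_eq ?_).trans (hN _ _ (by positivity))) _
        rw [← lintegral_indicator measurableSet_ball]
        refine lintegral_congr fun y => ?_
        by_cases hy : y ∈ ball x₀ (2 * r)
        · simp [hh, hy]
        · simp [hh, hy, hρ0]
    _ = _ := by
        rw [measure_ball_mul μ x₀ (by norm_num), ENNReal.mul_rpow_of_nonneg _ _ hκ0,
          ENNReal.ofReal_ofNat, hD]
        ring

end LocalMaximal

/-! ### Homogeneous functions of degree zero -/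

section Homogeneous
set_option linter.unusedSectionVars false

variable {E : Type*} [NormedAddCommGroup E] [NormedSpace ℝ E] [FiniteDimensional ℝ E]
  [MeasurableSpace E] [BorelSpace E] (μ : Measure E) [μ.IsAddHaarMeasure]

theorem map_val_comap_compl_zero [Nontrivial E] :
    (μ.comap ((↑) : ({0}ᶜ : Set E) → E)).map (↑) = μ := by
  rw [(MeasurableEmbedding.subtype_coe (measurableSet_singleton (0 : E)).compl).map_comap,
    Subtype.range_coe, Measure.restrict_eq_self_of_ae_mem]
  exact compl_mem_ae_iff.2 (measure_singleton 0)

theorem comp_homeomorphUnitSphereProd_fst {Ω : E → ℂ} (hΩ : ∀ t : ℝ, 0 < t → ∀ x, Ω (t • x) = Ω x) :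
    (fun z : sphere (0 : E) 1 × Set.Ioi (0 : ℝ) => Ω z.1) ∘ homeomorphUnitSphereProd E =
      Ω ∘ ((↑) : ({0}ᶜ : Set E) → E) := by
  ext x
  simp only [Function.comp_apply, homeomorphUnitSphereProd_apply_fst_coe]
  exact hΩ _ (inv_pos.2 (norm_pos_iff.2 x.2)) _

theorem aestronglyMeasurable_of_homogeneous [Nontrivial E] {Ω : E → ℂ}
    (hΩ : ∀ t : ℝ, 0 < t → ∀ x, Ω (t • x) = Ω x)
    (hm : AEStronglyMeasurable (fun x : sphere (0 : E) 1 => Ω x) μ.toSphere) :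
    AEStronglyMeasurable Ω μ := by
  rw [← map_val_comap_compl_zero μ,
    (MeasurableEmbedding.subtype_coe (measurableSet_singleton (0 : E)).compl
      ).aestronglyMeasurable_map_iff, ← comp_homeomorphUnitSphereProd_fst hΩ]
  exact hm.comp_fst.comp_measurePreserving μ.measurePreserving_homeomorphUnitSphereProd

/-- In polar coordinates a homogeneous function of degree zero depends on the angle only, so that
`L ^ s` integrability on the sphere passes to balls around the origin. -/
theorem memLp_ball_of_homogeneous [Nontrivial E] {Ω : E → ℂ}
    (hΩ : ∀ t : ℝ, 0 < t → ∀ x, Ω (t • x) = Ω x) {s : ℝ≥0∞}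
    (hs : MemLp (fun x : sphere (0 : E) 1 => Ω x) s μ.toSphere) :
    MemLp Ω s (μ.restrict (ball 0 1)) := by
  have hemb := MeasurableEmbedding.subtype_coe (measurableSet_singleton (0 : E)).compl
  set ν := (Measure.volumeIoiPow (Module.finrank ℝ E - 1)).restrict
    (Set.Iio (⟨1, Set.mem_Ioi.2 one_pos⟩ : Set.Ioi (0 : ℝ)))
  have : IsFiniteMeasure ν := ⟨by
    rw [Measure.restrict_apply_univ, Measure.volumeIoiPow_apply_Iio]
    exact ENNReal.ofReal_lt_top⟩
  have h1 := hs.comp_fst ν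
  rw [← Measure.restrict_univ (μ := μ.toSphere), Measure.prod_restrict] at h1
  have h2 := h1.comp_measurePreserving
    (μ.measurePreserving_homeomorphUnitSphereProd.restrict_preimage
      (MeasurableSet.univ.prod measurableSet_Iio))
  rw [comp_homeomorphUnitSphereProd_fst hΩ] at h2
  rw [← map_val_comap_compl_zero μ, hemb.restrict_map, hemb.memLp_map_measure_iff]
  convert h2 using 2
  ext x
  simp [← Subtype.coe_lt_coe]

theorem IsHomogeneousLs.memLp_toSphere {n : ℕ} (hn : n ≠ 0) {s : ℝ≥0∞}
    {Ω : EuclideanSpace ℝ (Fin n) → ℂ} (h : IsHomogeneousLs s Ω) :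
    MemLp (fun x : sphere (0 : EuclideanSpace ℝ (Fin n)) 1 => Ω x) s
      (volume : Measure (EuclideanSpace ℝ (Fin n))).toSphere := by
  have : Nonempty (Fin n) := ⟨⟨0, Nat.pos_of_ne_zero hn⟩⟩
  set c := (volume : Measure (EuclideanSpace ℝ (Fin n))).toSphere Set.univ with hc
  have hc0 : c ≠ 0 := by
    rw [hc, Ne, Measure.measure_univ_eq_zero]
    exact Measure.toSphere_ne_zero _
  have hc1 : c ≠ ∞ := measure_ne_top _ _
  have h1 := h.2.smul_measure hc1
  rwa [sphereMeasure, smul_smul, ENNReal.mul_inv_cancel hc0 hc1, one_smul] at h1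

/-- The map `y ↦ (x - y) / r` carries the uniform distribution on `B(x, r)` to that on the unit
ball. -/
theorem map_smul_sub_normalized_restrict_ball [Nontrivial E] (x : E) {r : ℝ} (hr : 0 < r) :
    ((μ (ball x r))⁻¹ • μ.restrict (ball x r)).map (fun y => r⁻¹ • (x - y)) =
      (μ (ball 0 1))⁻¹ • μ.restrict (ball 0 1) := by
  have hm : Measurable fun y : E => r⁻¹ • (x - y) := by fun_prop
  have hpre : (fun y : E => r⁻¹ • (x - y)) ⁻¹' ball 0 1 = ball x r := by
    ext y
    rw [Set.mem_preimage, mem_ball_zero_iff, mem_ball, dist_comm, dist_eq_norm, norm_smul, norm_inv,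
      Real.norm_eq_abs, abs_of_pos hr, inv_mul_lt_iff₀ hr, mul_one]
  have hmap : μ.map (fun y => r⁻¹ • (x - y)) = ENNReal.ofReal (r ^ Module.finrank ℝ E) • μ := by
    have h1 : μ.map (fun y => x - y) = μ := (Measure.measurePreserving_sub_left μ x).map_eq
    rw [show (fun y : E => r⁻¹ • (x - y)) = (fun z => r⁻¹ • z) ∘ fun y => x - y from rfl,
      ← Measure.map_map (by fun_prop) (by fun_prop), h1,
      Measure.map_addHaar_smul μ (inv_ne_zero hr.ne'), inv_pow, inv_inv, abs_of_pos (by positivity)]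
  have h0 : ENNReal.ofReal r ^ (Module.finrank ℝ E : ℝ) ≠ 0 := by simp [hr]
  have h1 : ENNReal.ofReal r ^ (Module.finrank ℝ E : ℝ) ≠ ∞ := by simp
  rw [Measure.map_smul, ← hpre, ← Measure.restrict_map hm measurableSet_ball, hmap, hpre,
    Measure.restrict_smul, smul_smul, ← mul_one r, measure_ball_mul μ x hr,
    Measure.addHaar_ball_center μ x, ENNReal.mul_inv (.inl h0) (.inl h1), mul_one,
    ENNReal.ofReal_pow hr.le, ← ENNReal.rpow_natCast, mul_right_comm, ENNReal.inv_mul_cancel h0 h1,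
    one_mul]

/-- Averages against a translated homogeneous function are controlled by `L ^ σ` averages, with a
constant that does not depend on the ball. -/
theorem exists_laverage_ball_enorm_mul_le [Nontrivial E] {Ω : E → ℂ}
    (hΩ : ∀ t : ℝ, 0 < t → ∀ x, Ω (t • x) = Ω x) {s : ℝ≥0∞} (hs1 : 1 < s)
    (hs : MemLp (fun x : sphere (0 : E) 1 => Ω x) s μ.toSphere) :
    ∃ K : ℝ≥0, ∀ f : E → ℂ, AEStronglyMeasurable f μ → ∀ (x : E) (r : ℝ), 0 < r →
      ⨍⁻ y in ball x r, ‖Ω (x - y)‖ₑ * ‖f y‖ₑ ∂μ ≤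
        K * (⨍⁻ y in ball x r, ‖f y‖ₑ ^ s.conjExponent.toReal ∂μ) ^ (1 / s.conjExponent.toReal) := by
  have hv0 : (μ (ball (0 : E) 1))⁻¹ ≠ ∞ := ENNReal.inv_ne_top.2 (measure_ball_pos μ _ one_pos).ne'
  have hK := ((memLp_ball_of_homogeneous μ hΩ hs).smul_measure hv0).eLpNorm_lt_top.ne
  have hΩm := aestronglyMeasurable_of_homogeneous μ hΩ hs.1
  have hconj : s.HolderConjugate s.conjExponent := .conjExponent hs1.le
  have hσ0 : s.conjExponent ≠ 0 := by simp [ENNReal.conjExponent]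
  have hσ1 : s.conjExponent ≠ ∞ := by
    simp [ENNReal.conjExponent, tsub_eq_zero_iff_le, not_le.2 hs1]
  refine ⟨(eLpNorm Ω s ((μ (ball 0 1))⁻¹ • μ.restrict (ball 0 1))).toNNReal,
    fun f hf x r hr => ?_⟩
  rw [ENNReal.coe_toNNReal hK]
  set ν := (μ (ball x r))⁻¹ • μ.restrict (ball x r) with hν
  have hmap := map_smul_sub_normalized_restrict_ball μ x hr
  have hcomp : (fun y => Ω (x - y)) = Ω ∘ fun y => r⁻¹ • (x - y) := by
    ext y
    exact (hΩ _ (inv_pos.2 hr) _).symm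
  have hT : Measurable fun y : E => r⁻¹ • (x - y) := by fun_prop
  have hΩν : AEStronglyMeasurable Ω (ν.map fun y => r⁻¹ • (x - y)) := by
    rw [hmap]
    exact (hΩm.restrict).smul_measure _
  have h1 : eLpNorm (fun y => Ω (x - y)) s ν =
      eLpNorm Ω s ((μ (ball 0 1))⁻¹ • μ.restrict (ball 0 1)) := by
    rw [← hmap, eLpNorm_map_measure hΩν hT.aemeasurable, hcomp]
  have hfν : AEStronglyMeasurable f ν := hf.restrict.smul_measure _
  have hΩν' : AEStronglyMeasurable (fun y => Ω (x - y)) ν := by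
    rw [hcomp]
    exact hΩν.comp_measurable hT
  have h2 := eLpNorm_smul_le_mul_eLpNorm (p := s) (q := s.conjExponent) (r := 1) hfν hΩν'
  rw [eLpNorm_one_eq_lintegral_enorm, h1, eLpNorm_eq_lintegral_rpow_enorm_toReal hσ0 hσ1] at h2
  simp only [Pi.smul_apply', smul_eq_mul, enorm_mul] at h2
  rw [setLAverage_eq', setLAverage_eq']
  exact h2

end Homogeneous

/-- Tonelli's theorem for a product of functions of one variable each. -/
theorem lintegral_pi_prod_eq {X : Type*} [MeasurableSpace X] (μ : Measure X) [SigmaFinite μ] :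
    ∀ {m : ℕ} {g : Fin m → X → ℝ≥0∞}, (∀ i, AEMeasurable (g i) μ) →
      ∫⁻ y : Fin m → X, ∏ i, g i (y i) ∂Measure.pi (fun _ => μ) = ∏ i, ∫⁻ x, g i x ∂μ := by
  intro m
  induction m with
  | zero => intro g _; simp
  | succ m ih =>
    intro g hg
    have hprod : AEMeasurable (fun y : Fin m → X => ∏ i, g i.succ (y i)) (Measure.pi fun _ => μ) :=
      Finset.aemeasurable_fun_prod _ fun i _ =>
        (hg i.succ).comp_quasiMeasurePreserving (Measure.quasiMeasurePreserving_eval _ i)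
    rw [Fin.prod_univ_succ, ← ih fun i => hg i.succ, ← lintegral_prod_mul (hg 0) hprod,
      ← (measurePreserving_piFinSuccAbove (fun _ => μ) 0).lintegral_comp_emb
        (MeasurableEquiv.measurableEmbedding _)]
    refine lintegral_congr fun y => ?_
    rw [Fin.prod_univ_succ]
    rfl

/-! ### Normalized functions in Morrey spaces -/

theorem lintegral_ball_enorm_rpow_le_morreyNorm {n : ℕ} {p κ : ℝ} (hp : 0 < p)
    (f : EuclideanSpace ℝ (Fin n) → ℂ) (x : EuclideanSpace ℝ (Fin n)) {r : ℝ} (hr : 0 < r) :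
    ∫⁻ y in ball x r, ‖f y‖ₑ ^ p ≤ morreyNorm p κ f ^ p * volume (ball x r) ^ κ := by
  have h0 : volume (ball x r) ≠ 0 := (measure_ball_pos _ x hr).ne'
  have h1 : volume (ball x r) ≠ ∞ := measure_ball_lt_top.ne
  have h : ((∫⁻ y in ball x r, ‖f y‖ₑ ^ p) / volume (ball x r) ^ κ) ^ (1 / p) ≤
      morreyNorm p κ f :=
    le_iSup_of_le x <| le_iSup_of_le r <| le_iSup_of_le hr le_rfl
  rw [one_div, ENNReal.rpow_inv_le_iff hp] at h
  rwa [ENNReal.div_le_iff (ENNReal.rpow_pos (pos_iff_ne_zero.2 h0) h1).ne'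
    (ENNReal.rpow_ne_top_of_nonneg' (pos_iff_ne_zero.2 h0) h1)] at h

theorem lintegral_ball_normalized_rpow_le {n : ℕ} {p κ : ℝ} (hp : 0 < p)
    {f : EuclideanSpace ℝ (Fin n) → ℂ} (hf : AEStronglyMeasurable f volume)
    (x : EuclideanSpace ℝ (Fin n)) {r : ℝ} (hr : 0 < r) :
    ∫⁻ y in ball x r, (‖f y‖ₑ / morreyNorm p κ f) ^ p ≤ volume (ball x r) ^ κ := by
  set N := morreyNorm p κ f with hN
  simp_rw [ENNReal.div_eq_inv_mul, ENNReal.mul_rpow_of_nonneg _ _ hp.le]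
  rw [lintegral_const_mul'' _ (hf.enorm.restrict.pow_const p)]
  calc N⁻¹ ^ p * ∫⁻ y in ball x r, ‖f y‖ₑ ^ p
      ≤ N⁻¹ ^ p * (N ^ p * volume (ball x r) ^ κ) :=
        mul_le_mul_right (lintegral_ball_enorm_rpow_le_morreyNorm hp f x hr) _
    _ = (N⁻¹ * N) ^ p * volume (ball x r) ^ κ := by
        rw [ENNReal.mul_rpow_of_nonneg _ _ hp.le, mul_assoc]
    _ ≤ 1 ^ p * volume (ball x r) ^ κ := by
        gcongr
        exact ENNReal.inv_mul_le_one _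
    _ = _ := by simp

/-- If the Morrey norm vanishes, then so does the left-hand side, by Jensen's inequality. -/
theorem laverage_ball_enorm_rpow_le_normalized {n : ℕ} {p σ κ : ℝ} (hσ : 0 < σ) (hσp : σ ≤ p)
    [NeZero n] {f : EuclideanSpace ℝ (Fin n) → ℂ} (hf : MemMorrey p κ f)
    (x : EuclideanSpace ℝ (Fin n)) {r : ℝ} (hr : 0 < r) :
    (⨍⁻ y in ball x r, ‖f y‖ₑ ^ σ ∂volume) ^ (1 / σ) ≤
      morreyNorm p κ f * (⨍⁻ y in ball x r, (‖f y‖ₑ / morreyNorm p κ f) ^ σ ∂volume) ^ (1 / σ) := by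
  have hp : 0 < p := hσ.trans_le hσp
  rcases eq_or_ne (morreyNorm p κ f) 0 with h0 | h0
  · rw [h0, zero_mul, nonpos_iff_eq_zero, ENNReal.rpow_eq_zero_iff_of_pos (by positivity)]
    have h1 := lintegral_ball_enorm_rpow_le_morreyNorm (κ := κ) hp f x hr
    rw [h0, ENNReal.zero_rpow_of_pos hp, zero_mul] at h1
    have h2 := laverage_ball_rpow_le volume (hf.1.enorm.pow_const σ) ((one_le_div hσ).2 hσp) x hr
    simp_rw [← ENNReal.rpow_mul, mul_div_cancel₀ _ hσ.ne'] at h2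
    rw [setLAverage_eq volume (fun y => ‖f y‖ₑ ^ p), nonpos_iff_eq_zero.1 h1, ENNReal.zero_div,
      nonpos_iff_eq_zero, ENNReal.rpow_eq_zero_iff_of_pos (by positivity)] at h2
    exact h2
  · have h1 : ∀ y, ‖f y‖ₑ ^ σ = morreyNorm p κ f ^ σ * (‖f y‖ₑ / morreyNorm p κ f) ^ σ := fun y => by
      rw [← ENNReal.mul_rpow_of_nonneg _ _ hσ.le, ENNReal.mul_div_cancel h0 hf.2.ne]
    have h2 : morreyNorm p κ f ^ σ ≠ ∞ := ENNReal.rpow_ne_top_of_nonneg hσ.le hf.2.ne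
    simp_rw [setLAverage_eq]
    conv_lhs => simp only [h1]
    rw [lintegral_const_mul' _ _ h2, mul_div_assoc, ENNReal.mul_rpow_of_nonneg _ _ (by positivity),
      ← ENNReal.rpow_mul, mul_one_div_cancel hσ.ne', ENNReal.rpow_one]

section Kernel

variable {n m : ℕ}

/-- The kernel is dominated by a sum of product kernels supported on dyadic balls. -/
theorem enorm_fracIntegrand_le_tsum {α : ℝ} (hα : α < (m : ℝ) * n)
    (Ω f : Fin m → EuclideanSpace ℝ (Fin n) → ℂ) (x : EuclideanSpace ℝ (Fin n))
    (y : Fin m → EuclideanSpace ℝ (Fin n)) :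
    ‖fracIntegrand α Ω f x y‖ₑ ≤ ∑' k : ℤ, (2 : ℝ≥0∞) ^ ((1 - k) * ((m : ℝ) * n - α)) *
      ∏ i, (ball x ((2 : ℝ) ^ k)).indicator (fun z => ‖Ω i (x - z)‖ₑ * ‖f i z‖ₑ) (y i) := by
  set β := (m : ℝ) * n - α with hβdef
  have hβ : 0 < β := by rw [hβdef]; linarith
  set ρ := Real.sqrt (∑ j, ‖x - y j‖ ^ 2) with hρ
  have hρ0 : 0 ≤ ρ := Real.sqrt_nonneg _
  -- At `ρ = 0` the kernel is `_ / 0 = 0`.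
  rcases hρ0.eq_or_lt with h | h
  · rw [fracIntegrand, ← hρ, ← h, Real.zero_rpow hβ.ne']
    simp
  obtain ⟨k, hk1, hk2⟩ := exists_mem_Ico_zpow h (one_lt_two (α := ℝ))
  have hmem : ∀ i, y i ∈ ball x ((2 : ℝ) ^ (k + 1)) := fun i => by
    rw [mem_ball, dist_comm, dist_eq_norm]
    refine lt_of_le_of_lt (Real.le_sqrt_of_sq_le ?_) hk2
    exact Finset.single_le_sum (f := fun j => ‖x - y j‖ ^ 2) (fun j _ => by positivity)
      (Finset.mem_univ i)
  refine le_trans ?_ (ENNReal.le_tsum (k + 1))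
  have hprod : ∏ i, (ball x ((2 : ℝ) ^ (k + 1))).indicator
      (fun z => ‖Ω i (x - z)‖ₑ * ‖f i z‖ₑ) (y i) = ∏ i, ‖Ω i (x - y i)‖ₑ * ‖f i (y i)‖ₑ :=
    Finset.prod_congr rfl fun i _ => Set.indicator_of_mem (hmem i) _
  have henorm : ∀ g : Fin m → ℂ, ‖∏ i, g i‖ₑ = ∏ i, ‖g i‖ₑ := fun g => by
    simp [enorm_eq_nnnorm]
  have hρβ : 0 < ρ ^ β := Real.rpow_pos_of_pos h _
  have hker : ‖((ρ ^ β : ℝ) : ℂ)⁻¹‖ₑ ≤ 2 ^ ((1 - ((k + 1 : ℤ) : ℝ)) * β) := by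
    rw [← Complex.ofReal_inv, ← ofReal_norm, Complex.norm_real,
      Real.norm_of_nonneg (by positivity),
      show (2 : ℝ≥0∞) = ENNReal.ofReal 2 by simp, ENNReal.ofReal_rpow_of_pos (by norm_num)]
    refine ENNReal.ofReal_le_ofReal ?_
    rw [show (1 - ((k + 1 : ℤ) : ℝ)) * β = -(k * β) by push_cast; ring,
      Real.rpow_neg (by norm_num), Real.rpow_mul (by norm_num), Real.rpow_intCast]
    gcongr
  rw [hprod, fracIntegrand, ← hρ, ← hβdef, div_eq_mul_inv, enorm_mul, enorm_mul,
    Finset.prod_mul_distrib, henorm, henorm]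
  calc (∏ i, ‖Ω i (x - y i)‖ₑ) * ‖((ρ ^ β : ℝ) : ℂ)⁻¹‖ₑ * ∏ i, ‖f i (y i)‖ₑ
      = ‖((ρ ^ β : ℝ) : ℂ)⁻¹‖ₑ * ((∏ i, ‖Ω i (x - y i)‖ₑ) * ∏ i, ‖f i (y i)‖ₑ) := by ring
    _ ≤ _ := mul_le_mul_left hker _

theorem aestronglyMeasurable_comp_sub_left {g : EuclideanSpace ℝ (Fin n) → ℂ}
    (hg : AEStronglyMeasurable g volume) (x : EuclideanSpace ℝ (Fin n)) :
    AEStronglyMeasurable (fun z => g (x - z)) volume :=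
  hg.comp_measurePreserving (Measure.measurePreserving_sub_left volume x)

theorem lintegral_enorm_fracIntegrand_le_tsum [NeZero n] {α : ℝ} (hα : α < (m : ℝ) * n)
    {Ω f : Fin m → EuclideanSpace ℝ (Fin n) → ℂ} (hΩ : ∀ i, AEStronglyMeasurable (Ω i) volume)
    (hf : ∀ i, AEStronglyMeasurable (f i) volume) (x : EuclideanSpace ℝ (Fin n)) :
    ∫⁻ y, ‖fracIntegrand α Ω f x y‖ₑ ≤
      2 ^ ((m : ℝ) * n - α) * volume (ball (0 : EuclideanSpace ℝ (Fin n)) 1) ^ m *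
        ∑' k : ℤ, (2 : ℝ≥0∞) ^ (k * α) *
          ∏ i, ⨍⁻ z in ball x ((2 : ℝ) ^ k), ‖Ω i (x - z)‖ₑ * ‖f i z‖ₑ ∂volume := by
  have h2 : (2 : ℝ≥0∞) ≠ 0 := by norm_num
  have h2' : (2 : ℝ≥0∞) ≠ ∞ := by norm_num
  set v := volume (ball (0 : EuclideanSpace ℝ (Fin n)) 1)
  have hmeas : ∀ (k : ℤ) i, AEMeasurable ((ball x ((2 : ℝ) ^ k)).indicator
      fun z => ‖Ω i (x - z)‖ₑ * ‖f i z‖ₑ) volume := fun k i =>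
    ((aestronglyMeasurable_comp_sub_left (hΩ i) x).enorm.mul (hf i).enorm).indicator
      measurableSet_ball
  have hmeas' : ∀ k : ℤ, AEMeasurable (fun y : Fin m → EuclideanSpace ℝ (Fin n) =>
      ∏ i, (ball x ((2 : ℝ) ^ k)).indicator (fun z => ‖Ω i (x - z)‖ₑ * ‖f i z‖ₑ) (y i)) volume :=
    fun k => Finset.aemeasurable_fun_prod _ fun i _ =>
      (hmeas k i).comp_quasiMeasurePreserving (Measure.quasiMeasurePreserving_eval _ i)
  calc ∫⁻ y, ‖fracIntegrand α Ω f x y‖ₑ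
      ≤ ∫⁻ y : Fin m → EuclideanSpace ℝ (Fin n),
          ∑' k : ℤ, (2 : ℝ≥0∞) ^ ((1 - k) * ((m : ℝ) * n - α)) *
          ∏ i, (ball x ((2 : ℝ) ^ k)).indicator (fun z => ‖Ω i (x - z)‖ₑ * ‖f i z‖ₑ) (y i) :=
        lintegral_mono fun y => enorm_fracIntegrand_le_tsum hα Ω f x y
    _ = ∑' k : ℤ, (2 : ℝ≥0∞) ^ ((1 - k) * ((m : ℝ) * n - α)) *
          ∏ i, ∫⁻ z in ball x ((2 : ℝ) ^ k), ‖Ω i (x - z)‖ₑ * ‖f i z‖ₑ := by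
        rw [lintegral_tsum fun k => (hmeas' k).const_mul _]
        refine tsum_congr fun k => ?_
        rw [lintegral_const_mul'' _ (hmeas' k), volume_pi, lintegral_pi_prod_eq volume (hmeas k)]
        simp_rw [lintegral_indicator measurableSet_ball]
    _ = _ := by
        rw [← ENNReal.tsum_mul_left]
        refine tsum_congr fun k => ?_
        have hB0 : volume (ball x ((2 : ℝ) ^ k)) ≠ 0 := (measure_ball_pos _ x (by positivity)).ne'
        have hB1 : volume (ball x ((2 : ℝ) ^ k)) ≠ ∞ := measure_ball_lt_top.ne
        have hav : ∀ i, ∫⁻ z in ball x ((2 : ℝ) ^ k), ‖Ω i (x - z)‖ₑ * ‖f i z‖ₑ =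
            2 ^ ((k : ℝ) * n) * v * ⨍⁻ z in ball x ((2 : ℝ) ^ k), ‖Ω i (x - z)‖ₑ * ‖f i z‖ₑ ∂volume :=
          fun i => by
          have := measure_ball_two_zpow volume x k
          rw [finrank_euclideanSpace_fin] at this
          rw [setLAverage_eq, ← this, ENNReal.mul_div_cancel hB0 hB1]
        simp_rw [hav]
        rw [Finset.prod_mul_distrib, Finset.prod_const, Finset.card_univ, Fintype.card_fin, mul_pow,
          ← ENNReal.rpow_natCast (2 ^ ((k : ℝ) * n)), ← ENNReal.rpow_mul, ← mul_assoc, ← mul_assoc,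
          ← mul_assoc, ← ENNReal.rpow_add _ _ h2 h2', mul_right_comm (2 ^ ((m : ℝ) * n - α)),
          ← ENNReal.rpow_add _ _ h2 h2']
        ring_nf

end Kernel

/-! ### Normalized maximal functions -/

theorem ENNReal.prod_rpow_eq_rpow_sum {ι : Type*} (t : Finset ι) (X : ℝ≥0∞) {e : ι → ℝ}
    (he : ∀ i, 0 ≤ e i) : ∏ i ∈ t, X ^ e i = X ^ ∑ i ∈ t, e i := by
  classical
  induction t using Finset.induction_on with
  | empty => simp
  | insert a t ha ih =>
    rw [Finset.prod_insert ha, Finset.sum_insert ha, ih,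
      ENNReal.rpow_add_of_nonneg _ _ (he a) (Finset.sum_nonneg fun i _ => he i)]

section NormalizedMaximal

variable {n : ℕ}

/-- The power `(M |u| ^ σ) ^ (p / σ)` of the maximal function of `u = f / ‖f‖`, where `‖f‖` is the
Morrey norm of `f`. The normalization makes the bounds on it independent of `f`; if `‖f‖ = 0`, then
`u` vanishes almost everywhere, because `0 / 0 = 0`. -/
noncomputable def normalizedMaximal (p σ κ : ℝ) (f : EuclideanSpace ℝ (Fin n) → ℂ)
    (x : EuclideanSpace ℝ (Fin n)) : ℝ≥0∞ :=
  dyadicMaximal volume (fun y => (‖f y‖ₑ / morreyNorm p κ f) ^ σ) x ^ (p / σ)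

variable {p σ κ : ℝ} {f : EuclideanSpace ℝ (Fin n) → ℂ}

theorem aemeasurable_normalized_rpow (hf : AEStronglyMeasurable f volume) (e : ℝ) :
    AEMeasurable (fun y => (‖f y‖ₑ / morreyNorm p κ f) ^ e) volume :=
  (hf.enorm.div_const _).pow_const e

theorem measurable_normalizedMaximal (hf : AEStronglyMeasurable f volume) :
    Measurable (normalizedMaximal p σ κ f) :=
  (measurable_dyadicMaximal volume (aemeasurable_normalized_rpow hf σ)).pow_const _

theorem exists_lintegral_ball_normalizedMaximal_le [NeZero n] (hσ : 0 < σ) (hσp : σ < p)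
    (hκ0 : 0 ≤ κ) (hκ : κ ≤ 1) :
    ∃ C : ℝ≥0, ∀ f : EuclideanSpace ℝ (Fin n) → ℂ, AEStronglyMeasurable f volume →
      ∀ x r, 0 < r →
        ∫⁻ y in ball x r, normalizedMaximal p σ κ f y ≤ C * volume (ball x r) ^ κ := by
  obtain ⟨C, hC⟩ := exists_lintegral_ball_dyadicMaximal_rpow_le
    (volume : Measure (EuclideanSpace ℝ (Fin n))) ((one_lt_div hσ).2 hσp) hκ0 hκ
  refine ⟨C, fun f hf x r hr => ?_⟩
  have := hC _ 1 (aemeasurable_normalized_rpow (p := p) (κ := κ) hf σ) (fun x r hr => ?_) x r hr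
  · rwa [one_mul] at this
  · simp_rw [← ENNReal.rpow_mul, mul_div_cancel₀ _ hσ.ne', one_mul]
    exact lintegral_ball_normalized_rpow_le (hσ.trans hσp) hf x hr

theorem exists_mul_measure_ball_lt_normalizedMaximal_le [NeZero n] (hσ : 0 < σ) (hσp : σ ≤ p)
    (hκ0 : 0 ≤ κ) (hκ : κ ≤ 1) :
    ∃ C : ℝ≥0, ∀ f : EuclideanSpace ℝ (Fin n) → ℂ, AEStronglyMeasurable f volume →
      ∀ x r, 0 < r → ∀ t,
        t * volume {y ∈ ball x r | t < normalizedMaximal p σ κ f y} ≤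
          C * volume (ball x r) ^ κ := by
  obtain ⟨C, hC⟩ := exists_mul_measure_ball_lt_dyadicMaximal_le
    (volume : Measure (EuclideanSpace ℝ (Fin n))) hκ0 hκ
  refine ⟨C, fun f hf x r hr t => ?_⟩
  have := hC _ 1 (aemeasurable_normalized_rpow (p := p) (κ := κ) hf p) (fun x r hr => ?_) x r hr t
  · rw [one_mul] at this
    refine le_trans (mul_le_mul_right (measure_mono ?_) t) this
    refine fun y hy => ⟨hy.1, hy.2.trans_le ?_⟩
    have h := dyadicMaximal_rpow_le volume (aemeasurable_normalized_rpow (p := p) (κ := κ) hf σ)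
      ((one_le_div hσ).2 hσp) y
    simp_rw [← ENNReal.rpow_mul, mul_div_cancel₀ _ hσ.ne'] at h
    exact h
  · rw [one_mul]
    exact lintegral_ball_normalized_rpow_le (hσ.trans_le hσp) hf x hr

theorem ae_normalizedMaximal_lt_top [NeZero n] (hσ : 0 < σ) (hσp : σ ≤ p)
    (hκ0 : 0 ≤ κ) (hκ : κ ≤ 1) (hf : AEStronglyMeasurable f volume) :
    ∀ᵐ x, normalizedMaximal p σ κ f x < ∞ := by
  obtain ⟨C, hC⟩ := exists_mul_measure_ball_lt_normalizedMaximal_le (n := n) hσ hσp hκ0 hκ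
  have hball : ∀ k : ℕ, volume {y ∈ ball (0 : EuclideanSpace ℝ (Fin n)) (k + 1) |
      normalizedMaximal p σ κ f y = ∞} = 0 := by
    intro k
    set a := volume {y ∈ ball (0 : EuclideanSpace ℝ (Fin n)) (k + 1) |
      normalizedMaximal p σ κ f y = ∞} with ha
    have ha1 : a ≠ ∞ := ((measure_mono fun y hy => hy.1).trans_lt measure_ball_lt_top).ne
    by_contra h0
    set c := C * volume (ball (0 : EuclideanSpace ℝ (Fin n)) (k + 1)) ^ κ
    have hc : c ≠ ∞ := ENNReal.mul_ne_top (by simp)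
      (ENNReal.rpow_ne_top_of_nonneg hκ0 measure_ball_lt_top.ne)
    have ht : (c + 1) / a < ∞ := ENNReal.div_lt_top (by simp [hc]) h0
    have hsub : {y ∈ ball (0 : EuclideanSpace ℝ (Fin n)) (k + 1) |
        normalizedMaximal p σ κ f y = ∞} ⊆ {y ∈ ball (0 : EuclideanSpace ℝ (Fin n)) (k + 1) |
        (c + 1) / a < normalizedMaximal p σ κ f y} :=
      fun y hy => ⟨hy.1, by rw [hy.2]; exact ht⟩
    have h1 : (c + 1) / a * a ≤ c :=
      (mul_le_mul_right (measure_mono hsub) _).trans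
        (hC f hf 0 (k + 1) (by positivity) ((c + 1) / a))
    rw [ENNReal.div_mul_cancel h0 ha1] at h1
    exact absurd h1 (not_le.2 (ENNReal.lt_add_right hc one_ne_zero))
  rw [ae_iff]
  refine measure_mono_null (fun y hy => ?_) (measure_iUnion_null hball)
  obtain ⟨k, hk⟩ := exists_nat_gt ‖y‖
  exact Set.mem_iUnion.2 ⟨k, by rw [mem_ball_zero_iff]; linarith, not_lt_top_iff.1 hy⟩

/-- Averages of the normalized function are bounded both by its maximal function and by the Morrey
condition. -/
theorem laverage_ball_normalized_rpow_le [NeZero n] (hσ : 0 < σ) (hσp : σ ≤ p)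
    (hf : AEStronglyMeasurable f volume) (x : EuclideanSpace ℝ (Fin n)) (k : ℤ) :
    (⨍⁻ y in ball x ((2 : ℝ) ^ k), (‖f y‖ₑ / morreyNorm p κ f) ^ σ ∂volume) ^ (1 / σ) ≤
      min (normalizedMaximal p σ κ f x) (volume (ball x ((2 : ℝ) ^ k)) ^ (κ - 1)) ^ (1 / p) := by
  have hp : 0 < p := hσ.trans_le hσp
  have hr : 0 < (2 : ℝ) ^ k := by positivity
  rw [show 1 / σ = p / σ * (1 / p) by field_simp, ENNReal.rpow_mul]
  refine ENNReal.rpow_le_rpow (le_min ?_ ?_) (by positivity)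
  · exact ENNReal.rpow_le_rpow (le_iSup (fun k : ℤ => ⨍⁻ y in ball x ((2 : ℝ) ^ k),
      (‖f y‖ₑ / morreyNorm p κ f) ^ σ ∂volume) k) (by positivity)
  · refine (laverage_ball_rpow_le volume (aemeasurable_normalized_rpow hf σ)
      ((one_le_div hσ).2 hσp) x hr).trans ?_
    simp_rw [← ENNReal.rpow_mul, mul_div_cancel₀ _ hσ.ne']
    have := laverage_ball_le_of_lintegral_ball_le volume (N := 1) hr
      ((lintegral_ball_normalized_rpow_le (κ := κ) hp hf x hr).trans_eq (one_mul _).symm)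
    rwa [one_mul] at this

end NormalizedMaximal

/-! ### Hedberg's pointwise inequality -/

section Pointwise

variable {n m : ℕ}

/-- Hedberg's pointwise inequality: the averages over small balls are estimated by the maximal
functions, those over large balls by the Morrey condition. -/
theorem exists_lintegral_enorm_fracIntegrand_le [NeZero n] {s : ℝ≥0∞} (hs : 1 < s)
    {Ω : Fin m → EuclideanSpace ℝ (Fin n) → ℂ} (hΩ : ∀ i, IsHomogeneousLs s (Ω i))
    {α : ℝ} (hα0 : 0 < α) (hα : α < (m : ℝ) * n) {p : Fin m → ℝ} {σ : ℝ}
    (hσ : σ = s.conjExponent.toReal) (hσ0 : 0 < σ) (hσp : ∀ i, σ ≤ p i) {P q κ : ℝ}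
    (hP0 : 0 < P) (hP : 1 / P = ∑ i, 1 / p i) (hκ : κ < 1) (hb : α < n * (1 - κ) / P)
    (hq : 1 / q = 1 / P - α / (n * (1 - κ))) :
    ∃ C : ℝ≥0, ∀ f : Fin m → EuclideanSpace ℝ (Fin n) → ℂ, (∀ i, MemMorrey (p i) κ (f i)) →
      ∀ x, ∫⁻ y, ‖fracIntegrand α Ω f x y‖ₑ ≤ C * (∏ i, morreyNorm (p i) κ (f i)) *
        (∑ i, normalizedMaximal (p i) σ κ (f i) x) ^ (1 / q) := by
  have hn : n ≠ 0 := NeZero.ne n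
  have hn0 : (0 : ℝ) < n := by positivity
  have hΩs := fun i => (hΩ i).memLp_toSphere hn
  have hΩm := fun i => aestronglyMeasurable_of_homogeneous volume (hΩ i).1 (hΩs i).1
  choose K hK using fun i => exists_laverage_ball_enorm_mul_le volume (hΩ i).1 hs (hΩs i)
  simp only [← hσ] at hK
  set b := n * (1 - κ) / P with hbdef
  have hκ' : 0 < 1 - κ := by linarith
  have hb0 : 0 < b := hα0.trans hb
  obtain ⟨C₀, hC₀⟩ := exists_tsum_two_rpow_mul_min_le hα0 hb
  set v := volume (ball (0 : EuclideanSpace ℝ (Fin n)) 1)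
  have hv0 : v ≠ 0 := (measure_ball_pos _ _ one_pos).ne'
  have hv1 : v ≠ ∞ := measure_ball_lt_top.ne
  set V := v ^ ((κ - 1) * (1 / P))
  have hV : V ≠ ∞ := ENNReal.rpow_ne_top_of_nonneg' (pos_iff_ne_zero.2 hv0) hv1
  have h2 : (2 : ℝ≥0∞) ≠ 0 := by norm_num
  have h2' : (2 : ℝ≥0∞) ≠ ∞ := by norm_num
  set D := 2 ^ ((m : ℝ) * n - α) * v ^ m * (∏ i, (K i : ℝ≥0∞)) * C₀ * V ^ (α / b)
  have hD : D ≠ ∞ := by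
    refine ENNReal.mul_ne_top (ENNReal.mul_ne_top (ENNReal.mul_ne_top (ENNReal.mul_ne_top
      ?_ ?_) ?_) ?_) ?_
    · exact ENNReal.rpow_ne_top_of_nonneg (by linarith) h2'
    · exact ENNReal.pow_ne_top hv1
    · exact ENNReal.prod_ne_top fun i _ => ENNReal.coe_ne_top
    · exact ENNReal.coe_ne_top
    · exact ENNReal.rpow_ne_top_of_nonneg (by positivity) hV
  refine ⟨D.toNNReal, fun f hf x => ?_⟩
  rw [ENNReal.coe_toNNReal hD]
  set N := fun i => morreyNorm (p i) κ (f i)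
  set S := ∑ i, normalizedMaximal (p i) σ κ (f i) x
  have hp : ∀ i, 0 < p i := fun i => hσ0.trans_le (hσp i)
  have hp' : ∀ i, 0 ≤ 1 / p i := fun i => (one_div_pos.2 (hp i)).le
  have hterm : ∀ k : ℤ, ∏ i, ⨍⁻ z in ball x ((2 : ℝ) ^ k), ‖Ω i (x - z)‖ₑ * ‖f i z‖ₑ ∂volume ≤
      (∏ i, (K i : ℝ≥0∞)) * (∏ i, N i) * min (S ^ (1 / P)) (2 ^ (-(k * b)) * V) := by
    intro k
    set B := volume (ball x ((2 : ℝ) ^ k)) with hB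
    have hBV : (B ^ (κ - 1)) ^ (1 / P) = 2 ^ (-(k * b)) * V := by
      rw [hB, measure_ball_two_zpow, finrank_euclideanSpace_fin, ← ENNReal.rpow_mul,
        ENNReal.mul_rpow_of_ne_top (ENNReal.rpow_ne_top_of_nonneg' (by norm_num) h2') hv1,
        ← ENNReal.rpow_mul]
      congr 2
      rw [hbdef]
      field_simp
      ring
    calc ∏ i, ⨍⁻ z in ball x ((2 : ℝ) ^ k), ‖Ω i (x - z)‖ₑ * ‖f i z‖ₑ ∂volume
        ≤ ∏ i, (K i * N i) * min S (B ^ (κ - 1)) ^ (1 / p i) := by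
          refine Finset.prod_le_prod' fun i _ => ?_
          refine (hK i (f i) (hf i).1 x _ (by positivity)).trans ?_
          rw [mul_assoc]
          refine mul_le_mul_right ?_ _
          refine (laverage_ball_enorm_rpow_le_normalized hσ0 (hσp i) (hf i) x
            (by positivity)).trans (mul_le_mul_right ?_ _)
          refine (laverage_ball_normalized_rpow_le hσ0 (hσp i) (hf i).1 x k).trans ?_
          refine ENNReal.rpow_le_rpow (min_le_min_right _ ?_) (hp' i)
          exact Finset.single_le_sum (f := fun i => normalizedMaximal (p i) σ κ (f i) x)
            (fun _ _ => zero_le) (Finset.mem_univ i)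
      _ = (∏ i, (K i : ℝ≥0∞)) * (∏ i, N i) * min S (B ^ (κ - 1)) ^ (1 / P) := by
          rw [Finset.prod_mul_distrib, Finset.prod_mul_distrib,
            ENNReal.prod_rpow_eq_rpow_sum _ _ hp', hP]
      _ ≤ _ := by
          rw [← hBV]
          refine mul_le_mul_right (le_min ?_ ?_) _
          · exact ENNReal.rpow_le_rpow (min_le_left _ _) (by positivity)
          · exact ENNReal.rpow_le_rpow (min_le_right _ _) (by positivity)
  -- The relation between `P` and `q` is exactly this one.
  have hexp : 1 / P * (1 - α / b) = 1 / q := by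
    rw [hq, hbdef]
    field_simp
  calc ∫⁻ y, ‖fracIntegrand α Ω f x y‖ₑ
      ≤ 2 ^ ((m : ℝ) * n - α) * v ^ m * ∑' k : ℤ, (2 : ℝ≥0∞) ^ (k * α) *
          ∏ i, ⨍⁻ z in ball x ((2 : ℝ) ^ k), ‖Ω i (x - z)‖ₑ * ‖f i z‖ₑ ∂volume :=
        lintegral_enorm_fracIntegrand_le_tsum hα hΩm (fun i => (hf i).1) x
    _ ≤ 2 ^ ((m : ℝ) * n - α) * v ^ m * ∑' k : ℤ, (∏ i, (K i : ℝ≥0∞)) * (∏ i, N i) *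
          ((2 : ℝ≥0∞) ^ (k * α) * min (S ^ (1 / P)) (2 ^ (-(k * b)) * V)) := by
        refine mul_le_mul_right (ENNReal.tsum_le_tsum fun k => ?_) _
        rw [mul_left_comm]
        exact mul_le_mul_right (hterm k) _
    _ ≤ 2 ^ ((m : ℝ) * n - α) * v ^ m * ((∏ i, (K i : ℝ≥0∞)) * (∏ i, N i) *
          (C₀ * ((S ^ (1 / P)) ^ (1 - α / b) * V ^ (α / b)))) := by
        rw [ENNReal.tsum_mul_left]
        exact mul_le_mul_right (mul_le_mul_right (hC₀ _ _) _) _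
    _ = _ := by
        rw [← ENNReal.rpow_mul, hexp]
        ring

theorem aestronglyMeasurable_fracIntegrand_prod {α : ℝ}
    {Ω f : Fin m → EuclideanSpace ℝ (Fin n) → ℂ} (hΩ : ∀ i, AEStronglyMeasurable (Ω i) volume)
    (hf : ∀ i, AEStronglyMeasurable (f i) volume) :
    AEStronglyMeasurable (fun z : EuclideanSpace ℝ (Fin n) × (Fin m → EuclideanSpace ℝ (Fin n)) =>
      fracIntegrand α Ω f z.1 z.2) (volume.prod volume) := by
  have heval : ∀ i : Fin m, Measure.QuasiMeasurePreserving
      (fun y : Fin m → EuclideanSpace ℝ (Fin n) => y i) volume volume := fun i =>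
    Measure.quasiMeasurePreserving_eval _ i
  have hsub : ∀ i : Fin m, Measure.QuasiMeasurePreserving
      (fun z : EuclideanSpace ℝ (Fin n) × (Fin m → EuclideanSpace ℝ (Fin n)) => z.1 - z.2 i)
      (volume.prod volume) volume := fun i =>
    QuasiMeasurePreserving.prod_of_left (by fun_prop) <| .of_forall fun y =>
      (measurePreserving_sub_right volume (y i)).quasiMeasurePreserving
  have hker : Measurable fun z : EuclideanSpace ℝ (Fin n) × (Fin m → EuclideanSpace ℝ (Fin n)) =>
      ((Real.sqrt (∑ j, ‖z.1 - z.2 j‖ ^ 2) ^ ((m : ℝ) * (n : ℝ) - α) : ℝ) : ℂ) := by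
    fun_prop
  have h1 := Finset.aestronglyMeasurable_fun_prod Finset.univ fun i (_ : i ∈ Finset.univ) =>
    (hΩ i).comp_quasiMeasurePreserving (hsub i)
  have hsnd : ∀ i : Fin m, Measure.QuasiMeasurePreserving
      (fun z : EuclideanSpace ℝ (Fin n) × (Fin m → EuclideanSpace ℝ (Fin n)) => z.2 i)
      (volume.prod volume) volume := fun i => (heval i).comp Measure.quasiMeasurePreserving_snd
  have h2 := Finset.aestronglyMeasurable_fun_prod Finset.univ fun i (_ : i ∈ Finset.univ) =>
    (hf i).comp_quasiMeasurePreserving (hsnd i)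
  exact (h1.div₀ hker.aestronglyMeasurable).mul h2

end Pointwise

/-! ### Morrey norm bounds and the fractional integral -/

/-- The weak `L ^ 1` bound for a sum: where the sum exceeds `t`, one of the `m` summands exceeds
`t / m`. -/
theorem mul_measure_lt_sum_le {X : Type*} [MeasurableSpace X] {μ : Measure X} {m : ℕ}
    {B : Set X} {H : Fin m → X → ℝ≥0∞} {D : Fin m → ℝ≥0∞}
    (hH : ∀ i t, t * μ {y ∈ B | t < H i y} ≤ D i) (t : ℝ≥0∞) :
    t * μ {y ∈ B | t < ∑ i, H i y} ≤ m * ∑ i, D i := by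
  rcases Nat.eq_zero_or_pos m with rfl | hm
  · simp
  have hm0 : (m : ℝ≥0∞) ≠ 0 := by exact_mod_cast hm.ne'
  have hm1 : (m : ℝ≥0∞) ≠ ∞ := ENNReal.natCast_ne_top m
  have hsub : {y ∈ B | t < ∑ i, H i y} ⊆ ⋃ i, {y ∈ B | t / m < H i y} := by
    rintro y ⟨hy, ht⟩
    by_contra! hcon
    simp only [Set.mem_iUnion, not_exists] at hcon
    refine absurd ht (not_lt.2 ?_)
    calc ∑ i, H i y ≤ ∑ _i : Fin m, t / m :=
          Finset.sum_le_sum fun i _ => not_lt.1 fun h => hcon i ⟨hy, h⟩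
      _ = t := by
          rw [Finset.sum_const, Finset.card_univ, Fintype.card_fin, nsmul_eq_mul,
            ENNReal.mul_div_cancel hm0 hm1]
  calc t * μ {y ∈ B | t < ∑ i, H i y}
      ≤ t * ∑ i, μ {y ∈ B | t / m < H i y} := by
        refine mul_le_mul_right ((measure_mono hsub).trans ?_) _
        exact measure_iUnion_fintype_le μ _
    _ = m * ∑ i, t / m * μ {y ∈ B | t / m < H i y} := by
        rw [← Finset.mul_sum, ← mul_assoc, ENNReal.mul_div_cancel hm0 hm1]
    _ ≤ _ := mul_le_mul_right (Finset.sum_le_sum fun i _ => hH i _) _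

theorem morreyNorm_le_of_lintegral_le {n : ℕ} {q κ : ℝ} (hq : 0 < q) {A : ℝ≥0∞}
    {T : EuclideanSpace ℝ (Fin n) → ℂ}
    (h : ∀ x r, 0 < r → ∫⁻ y in ball x r, ‖T y‖ₑ ^ q ≤ A ^ q * volume (ball x r) ^ κ) :
    morreyNorm q κ T ≤ A := by
  refine iSup_le fun x => iSup_le fun r => iSup_le fun hr => ?_
  rw [one_div, ENNReal.rpow_inv_le_iff hq]
  exact ENNReal.div_le_of_le_mul (h x r hr)

theorem weakMorreyNorm_le_of_mul_measure_le {n : ℕ} {q κ : ℝ} (hq : 0 < q) {A : ℝ≥0∞}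
    {T : EuclideanSpace ℝ (Fin n) → ℂ}
    (h : ∀ x r, 0 < r → ∀ t, t ^ q * volume {y ∈ ball x r | t < ‖T y‖ₑ} ≤
      A ^ q * volume (ball x r) ^ κ) :
    weakMorreyNorm q κ T ≤ A := by
  refine iSup_le fun x => iSup_le fun r => iSup_le fun hr => iSup_le fun t => iSup_le fun ht => ?_
  refine ENNReal.div_le_of_le_mul ?_
  have hset : {y ∈ ball x r | t < ‖T y‖} = {y ∈ ball x r | ENNReal.ofReal t < ‖T y‖ₑ} := by
    ext y
    simp only [Set.mem_ofPred_eq, ← ofReal_norm]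
    rw [ENNReal.ofReal_lt_ofReal_iff_of_nonneg ht.le]
  have h1 := ENNReal.rpow_le_rpow (h x r hr (ENNReal.ofReal t)) (z := 1 / q) (by positivity)
  rw [ENNReal.mul_rpow_of_nonneg _ _ (by positivity), ENNReal.mul_rpow_of_nonneg _ _ (by positivity),
    ← ENNReal.rpow_mul, ← ENNReal.rpow_mul, ← ENNReal.rpow_mul, mul_one_div_cancel hq.ne',
    ENNReal.rpow_one, ENNReal.rpow_one, mul_one_div] at h1
  rw [hset]
  exact h1

theorem theorem4p3 (n m : ℕ) (hn : 2 ≤ n) (hm : 1 ≤ m)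
    (s : ℝ≥0∞) (hs : 1 < s)
    (Ω : Fin m → EuclideanSpace ℝ (Fin n) → ℂ) (hΩ : ∀ i, IsHomogeneousLs s (Ω i))
    (α : ℝ) (hα0 : 0 < α) (hα : α < (m : ℝ) * (n : ℝ))
    (p : Fin m → ℝ) (hps : ∀ i, s.conjExponent ≤ ENNReal.ofReal (p i))
    (P q κ : ℝ) (hP : 1 / P = ∑ i, 1 / p i)
    (hκ0 : 0 < κ) (hκ : κ < 1 - α * P / (n : ℝ))
    (hq : 1 / q = 1 / P - α / ((n : ℝ) * (1 - κ))) :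
    ((∀ i, s.conjExponent < ENNReal.ofReal (p i)) →
      ∃ C : ℝ≥0, ∀ f : Fin m → EuclideanSpace ℝ (Fin n) → ℂ,
        (∀ i, MemMorrey (p i) κ (f i)) →
          (∀ᵐ x, Integrable (fracIntegrand α Ω f x)) ∧
          MemMorrey q κ (fracIntegral α Ω f) ∧
          morreyNorm q κ (fracIntegral α Ω f) ≤ C * ∏ i, morreyNorm (p i) κ (f i)) ∧
    (IsLeast (Set.range fun i => ENNReal.ofReal (p i)) s.conjExponent →
      ∃ C : ℝ≥0, ∀ f : Fin m → EuclideanSpace ℝ (Fin n) → ℂ,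
        (∀ i, MemMorrey (p i) κ (f i)) →
          (∀ᵐ x, Integrable (fracIntegrand α Ω f x)) ∧
          MemWeakMorrey q κ (fracIntegral α Ω f) ∧
          weakMorreyNorm q κ (fracIntegral α Ω f) ≤ C * ∏ i, morreyNorm (p i) κ (f i)) := by
  have hn' : NeZero n := ⟨by omega⟩
  have hn0 : (0 : ℝ) < n := by positivity
  have hs1 : s.conjExponent ≠ ∞ := by
    simp [ENNReal.conjExponent, tsub_eq_zero_iff_le, not_le.2 hs]
  obtain ⟨σ, hσ⟩ : ∃ σ, σ = s.conjExponent.toReal := ⟨_, rfl⟩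
  have hσ0 : 0 < σ := by
    rw [hσ]
    exact ENNReal.toReal_pos (by simp [ENNReal.conjExponent]) hs1
  have hp0 : ∀ i, 0 < p i := fun i => by
    rw [← ENNReal.ofReal_pos]
    exact lt_of_lt_of_le (by simp [ENNReal.conjExponent]) (hps i)
  have hσp : ∀ i, σ ≤ p i := fun i => by
    rw [hσ]
    exact ENNReal.toReal_le_of_le_ofReal (hp0 i).le (hps i)
  have hP0 : 0 < P := by
    rw [← one_div_pos, hP]
    exact Finset.sum_pos (fun i _ => one_div_pos.2 (hp0 i)) ⟨⟨0, hm⟩, Finset.mem_univ _⟩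
  have hκ1 : κ < 1 := by
    have : 0 < α * P / n := by positivity
    linarith
  have hκ' : 0 < 1 - κ := by linarith
  have hαP : α * P < n * (1 - κ) := by
    have : α * P / n < 1 - κ := by linarith
    rw [div_lt_iff₀ hn0] at this
    linarith
  have hb : α < n * (1 - κ) / P := by rwa [lt_div_iff₀ hP0]
  have hq0 : 0 < q := by
    rw [← one_div_pos, hq, sub_pos, div_lt_div_iff₀ (by positivity) hP0, one_mul]
    exact hαP
  have hΩm := fun i => aestronglyMeasurable_of_homogeneous volume (hΩ i).1
    ((hΩ i).memLp_toSphere hn'.out).1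
  obtain ⟨C, hC⟩ := exists_lintegral_enorm_fracIntegrand_le hs hΩ hα0 hα hσ hσ0 hσp hP0 hP hκ1 hb hq
  have hCq : ∀ f : Fin m → EuclideanSpace ℝ (Fin n) → ℂ, (∀ i, MemMorrey (p i) κ (f i)) →
      ∀ x, ‖fracIntegral α Ω f x‖ₑ ^ q ≤ (C * ∏ i, morreyNorm (p i) κ (f i)) ^ q *
        ∑ i, normalizedMaximal (p i) σ κ (f i) x := fun f hf x => by
    refine (ENNReal.rpow_le_rpow ((enorm_integral_le_lintegral_enorm _).trans (hC f hf x))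
      hq0.le).trans_eq ?_
    rw [ENNReal.mul_rpow_of_nonneg _ _ hq0.le, ← ENNReal.rpow_mul, one_div_mul_cancel hq0.ne',
      ENNReal.rpow_one]
  have hN : ∀ f : Fin m → EuclideanSpace ℝ (Fin n) → ℂ, (∀ i, MemMorrey (p i) κ (f i)) →
      ∏ i, morreyNorm (p i) κ (f i) ≠ ∞ := fun f hf =>
    ENNReal.prod_ne_top fun i _ => (hf i).2.ne
  have hmeas : ∀ f : Fin m → EuclideanSpace ℝ (Fin n) → ℂ, (∀ i, MemMorrey (p i) κ (f i)) →
      AEStronglyMeasurable (fracIntegral α Ω f) volume := fun f hf =>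
    (aestronglyMeasurable_fracIntegrand_prod hΩm fun i => (hf i).1).integral_prod_right'
  have hint : ∀ f : Fin m → EuclideanSpace ℝ (Fin n) → ℂ, (∀ i, MemMorrey (p i) κ (f i)) →
      ∀ᵐ x, Integrable (fracIntegrand α Ω f x) := fun f hf => by
    have h1 := (aestronglyMeasurable_fracIntegrand_prod (α := α) hΩm
      fun i => (hf i).1).prodMk_left
    have h2 : ∀ᵐ x, ∀ i, normalizedMaximal (p i) σ κ (f i) x < ∞ :=
      ae_all_iff.2 fun i => ae_normalizedMaximal_lt_top hσ0 (hσp i) hκ0.le hκ1.le (hf i).1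
    filter_upwards [h1, h2] with x hx1 hx2
    refine ⟨hx1, (hC f hf x).trans_lt (ENNReal.mul_lt_top (ENNReal.mul_lt_top (by simp)
      (hN f hf).lt_top) ?_)⟩
    exact ENNReal.rpow_lt_top_of_nonneg (by positivity) (ENNReal.sum_ne_top.2 fun i _ => (hx2 i).ne)
  -- Taking a constant `D` out of `(C * D ^ (1 / q) * N) ^ q`.
  have hroot : ∀ (D : ℝ≥0) (N : ℝ≥0∞),
      (((C * D ^ (1 / q) : ℝ≥0) : ℝ≥0∞) * N) ^ q = (C * N) ^ q * D := fun D N => by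
    rw [ENNReal.coe_mul, ENNReal.coe_rpow_of_nonneg _ (by positivity), mul_right_comm,
      ENNReal.mul_rpow_of_nonneg _ _ hq0.le, ← ENNReal.rpow_mul, one_div_mul_cancel hq0.ne',
      ENNReal.rpow_one]
  constructor
  · intro hlt
    have hσp' : ∀ i, σ < p i := fun i => by
      rw [hσ]
      exact (ENNReal.lt_ofReal_iff_toReal_lt hs1).1 (hlt i)
    choose D hD using fun i =>
      exists_lintegral_ball_normalizedMaximal_le (n := n) hσ0 (hσp' i) hκ0.le hκ1.le
    refine ⟨C * (∑ i, D i) ^ (1 / q), fun f hf => ?_⟩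
    have hle : morreyNorm q κ (fracIntegral α Ω f) ≤
        ((C * (∑ i, D i) ^ (1 / q) : ℝ≥0) : ℝ≥0∞) * ∏ i, morreyNorm (p i) κ (f i) := by
      refine morreyNorm_le_of_lintegral_le hq0 fun x r hr => ?_
      have hm1 : ∀ i, Measurable (normalizedMaximal (p i) σ κ (f i)) := fun i =>
        measurable_normalizedMaximal (hf i).1
      calc ∫⁻ y in ball x r, ‖fracIntegral α Ω f y‖ₑ ^ q
          ≤ ∫⁻ y in ball x r, (C * ∏ i, morreyNorm (p i) κ (f i)) ^ q *
              ∑ i, normalizedMaximal (p i) σ κ (f i) y := lintegral_mono fun y => hCq f hf y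
        _ = (C * ∏ i, morreyNorm (p i) κ (f i)) ^ q *
              ∑ i, ∫⁻ y in ball x r, normalizedMaximal (p i) σ κ (f i) y := by
            rw [lintegral_const_mul _ (Finset.measurable_fun_sum _ fun i _ => hm1 i),
              lintegral_finsetSum _ fun i _ => hm1 i]
        _ ≤ (C * ∏ i, morreyNorm (p i) κ (f i)) ^ q *
              ∑ i, D i * volume (ball x r) ^ κ :=
            mul_le_mul_right (Finset.sum_le_sum fun i _ => hD i (f i) (hf i).1 x r hr) _
        _ = _ := by
            rw [hroot, ← Finset.sum_mul, ENNReal.ofNNReal_finsetSum, mul_assoc]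
    exact ⟨hint f hf, ⟨hmeas f hf, hle.trans_lt
      (ENNReal.mul_lt_top ENNReal.coe_lt_top (hN f hf).lt_top)⟩, hle⟩
  · intro _
    choose D hD using fun i =>
      exists_mul_measure_ball_lt_normalizedMaximal_le (n := n) hσ0 (hσp i) hκ0.le hκ1.le
    refine ⟨C * (m * ∑ i, D i) ^ (1 / q), fun f hf => ?_⟩
    have hle : weakMorreyNorm q κ (fracIntegral α Ω f) ≤
        ((C * (m * ∑ i, D i) ^ (1 / q) : ℝ≥0) : ℝ≥0∞) * ∏ i, morreyNorm (p i) κ (f i) := by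
      refine weakMorreyNorm_le_of_mul_measure_le hq0 fun x r hr t => ?_
      set c := (C * ∏ i, morreyNorm (p i) κ (f i)) ^ q with hc
      have hc1 : c ≠ ∞ :=
        ENNReal.rpow_ne_top_of_nonneg hq0.le (ENNReal.mul_ne_top ENNReal.coe_ne_top (hN f hf))
      have hlt : ∀ y, t < ‖fracIntegral α Ω f y‖ₑ →
          t ^ q < c * ∑ i, normalizedMaximal (p i) σ κ (f i) y := fun y hy =>
        (ENNReal.rpow_lt_rpow hy hq0).trans_le (hCq f hf y)
      rcases eq_or_ne c 0 with hc0 | hc0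
      · have : {y ∈ ball x r | t < ‖fracIntegral α Ω f y‖ₑ} = ∅ :=
          Set.eq_empty_of_forall_notMem fun y hy => by
            have := hlt y hy.2
            rw [hc0, zero_mul] at this
            exact not_lt_zero this
        rw [this, measure_empty, mul_zero]
        exact zero_le
      have hsub : {y ∈ ball x r | t < ‖fracIntegral α Ω f y‖ₑ} ⊆
          {y ∈ ball x r | t ^ q / c < ∑ i, normalizedMaximal (p i) σ κ (f i) y} := fun y hy =>
        ⟨hy.1, ENNReal.div_lt_of_lt_mul' (hlt y hy.2)⟩
      calc t ^ q * volume {y ∈ ball x r | t < ‖fracIntegral α Ω f y‖ₑ}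
          ≤ t ^ q * volume {y ∈ ball x r |
              t ^ q / c < ∑ i, normalizedMaximal (p i) σ κ (f i) y} :=
            mul_le_mul_right (measure_mono hsub) _
        _ = c * (t ^ q / c * volume {y ∈ ball x r |
              t ^ q / c < ∑ i, normalizedMaximal (p i) σ κ (f i) y}) := by
            rw [← mul_assoc, ENNReal.mul_div_cancel hc0 hc1]
        _ ≤ c * (m * ∑ i, D i * volume (ball x r) ^ κ) :=
            mul_le_mul_right (mul_measure_lt_sum_le (fun i t => hD i (f i) (hf i).1 x r hr t) _) _
        _ = _ := by
            rw [hroot, ← Finset.sum_mul, ENNReal.coe_mul, ENNReal.ofNNReal_finsetSum,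
              ENNReal.coe_natCast, mul_assoc, mul_assoc]
    exact ⟨hint f hf, ⟨hmeas f hf, hle.trans_lt
      (ENNReal.mul_lt_top ENNReal.coe_lt_top (hN f hf).lt_top)⟩, hle⟩
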